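/- Let $\mathbf\Lambda(X)$ and $\mathbf\Lambda(Y)$ be the rings of symmetric functions over $\mathbb{Q}$ (symmetric formal power series of bounded degree) in the countably many variables $X=\{x_1,x_2,\dots\}$ and $Y=\{y_1,y_2,\dots\}$, and let $\mathbf\Lambda(X,Y)=\mathbf\Lambda(X)\otimes_{\mathbb{Q}}\mathbf\Lambda(Y)$. Let $\mathbf p_k,\mathbf h_k$ ($\tilde{\mathbf p}_k,\tilde{\mathbf h}_k$) be the power sums and the complete homogeneous symmetric functions in $X$ (in $Y$), with $\mathbf h_k=\tilde{\mathbf h}_k=0$ for $k<0$. The ring $\mathbf\Lambda(X,Y)$ is the polynomial ring over $\mathbb{Q}$ in $\mathbf p_1,\mathbf p_2,\dots,\tilde{\mathbf p}_1,\tilde{\mathbf p}_2,\dots$; let $\partial_{\mathbf p_k},\partial_{\tilde{\mathbf p}_k}$ be its partial derivatives. Let $V=\mathbb{Q}[[p_1,p_2,\dots,\tilde p_1,\tilde p_2,\dots]]$, with partial derivatives $\partial_{p_k},\partial_{\tilde p_k}$, and let $F:\mathbf\Lambda(X,Y)\to V$ be the algebra homomorphism with $F(\mathbf p_k)=p_k$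 and $F(\tilde{\mathbf p}_k)=\tilde p_k$. Put $$\mathbf\Delta=\exp\Big(\sum_{k\ge1}k\,\partial_{\mathbf p_k}\partial_{\tilde{\mathbf p}_k}\Big),\qquad \Delta=\exp\Big(\sum_{k\ge1}k\,\partial_{p_k}\partial_{\tilde p_k}\Big),$$ operators on $\mathbf\Lambda(X,Y)$ and on $V$ respectively; each is applied to those elements for which all the sums involved, $\sum_{k}$ and $\exp(T)=\sum_{n\ge 0}T^n/n!$, have only finitely many non-zero terms. For partitions $\lambda,\mu$ and an integer $d\ge\max(l(\lambda),l(\mu))$, where $l$ denotes the length, define $$\mathbf{TW}^{\lambda\mu}=\det\Big(\big(\tilde{\mathbf h}_{i-j+\mu_{d-i+1}}\big)_{1\le i\le d,\ j\ge1}\cdot\big(\mathbf h_{j-i+\lambda_{d-j+1}}\big)_{i\ge1,\ 1\le j\le d}\Big)\in\mathbf\Lambda(X,Y),\qquad TW^{\lambda\mu}=F(\mathbf{TW}^{\lambda\mu})\in V.$$ **Theorem.** Let $\lambda,\mu$ be partitions and let $\varnothing$ be the empty partition. Then, for any admissible choices of $d$ in the three determinants $\mathbf{TW}^{\lambda\varnothing},\mathbf{TW}^{\varnothing\mu},\mathbf{TW}^{\lambda\mu}$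 (the choices need not be equal), all sums in $\Delta(TW^{\lambda\varnothing}\cdot TW^{\varnothing\mu})$ and $\mathbf\Delta(\mathbf{TW}^{\lambda\varnothing}\cdot\mathbf{TW}^{\varnothing\mu})$ are finite, and $$\Delta\big(TW^{\lambda\varnothing}\cdot TW^{\varnothing\mu}\big)=TW^{\lambda\mu}\qquad\text{and}\qquad\mathbf\Delta\big(\mathbf{TW}^{\lambda\varnothing}\cdot\mathbf{TW}^{\varnothing\mu}\big)=\mathbf{TW}^{\lambda\mu}.$$ -/

import Mathlib

open scoped TensorProduct

noncomputable section

namespace TracyWidom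

/-! ### The ring of symmetric functions in countably many variables -/

/-- The ring `Λ` of symmetric functions over `ℚ` in the variables `x₀, x₁, x₂, …`: the formal power
series of bounded degree that are invariant under all permutations of the variables. -/
def SymFun : Subalgebra ℚ (MvPowerSeries ℕ ℚ) where
  carrier := {f | (∀ ρ : Equiv.Perm ℕ, MvPowerSeries.rename ρ f = f) ∧
    ∃ N : ℕ, ∀ m : ℕ →₀ ℕ, N < m.degree → MvPowerSeries.coeff m f = 0}
  mul_mem' := by
    rintro f g ⟨hf, N, hN⟩ ⟨hg, M, hM⟩
    refine ⟨fun ρ => by rw [map_mul, hf, hg], N + M, fun m hm => ?_⟩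
    classical
    rw [MvPowerSeries.coeff_mul]
    refine Finset.sum_eq_zero fun x hx => ?_
    rw [Finset.HasAntidiagonal.mem_antidiagonal] at hx
    rw [← hx, map_add] at hm
    rcases lt_or_ge N x.1.degree with h | h
    · rw [hN _ h, zero_mul]
    · rw [hM _ (by omega), mul_zero]
  add_mem' := by
    rintro f g ⟨hf, N, hN⟩ ⟨hg, M, hM⟩
    refine ⟨fun ρ => by rw [map_add, hf, hg], max N M, fun m hm => ?_⟩
    rw [map_add, hN _ (lt_of_le_of_lt (le_max_left _ _) hm),
      hM _ (lt_of_le_of_lt (le_max_right _ _) hm), add_zero]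
  algebraMap_mem' := by
    intro r
    refine ⟨fun ρ => AlgHom.commutes _ r, 0, fun m hm => ?_⟩
    classical
    rw [MvPowerSeries.algebraMap_apply, MvPowerSeries.coeff_C, if_neg]
    rintro rfl
    simp at hm

theorem mem_symFun_iff (f : MvPowerSeries ℕ ℚ) :
    f ∈ SymFun ↔ (∀ ρ : Equiv.Perm ℕ, MvPowerSeries.rename ρ f = f) ∧
      ∃ N : ℕ, ∀ m : ℕ →₀ ℕ, N < m.degree → MvPowerSeries.coeff m f = 0 := Iff.rfl

theorem rename_eq_iff (f : MvPowerSeries ℕ ℚ) :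
    (∀ ρ : Equiv.Perm ℕ, MvPowerSeries.rename ρ f = f) ↔ ∀ (ρ : Equiv.Perm ℕ) (m : ℕ →₀ ℕ),
      MvPowerSeries.coeff (m.mapDomain ρ) f = MvPowerSeries.coeff m f := by
  have key : ∀ (ρ : Equiv.Perm ℕ) (m : ℕ →₀ ℕ),
      MvPowerSeries.coeff (m.mapDomain ρ) (MvPowerSeries.rename ρ f)
        = MvPowerSeries.coeff m f := by
    intro ρ m
    have := MvPowerSeries.coeff_embDomain_rename ρ.toEmbedding f m
    rw [Finsupp.embDomain_eq_mapDomain] at this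
    exact this
  constructor
  · intro h ρ m
    conv_lhs => rw [← h ρ]
    exact key ρ m
  · intro h ρ
    ext m
    obtain ⟨m, rfl⟩ : ∃ m', m = Finsupp.mapDomain ρ m' := by
      refine ⟨m.mapDomain ρ.symm, ?_⟩
      rw [← Finsupp.mapDomain_comp]
      simp
    rw [key, h]

open Classical in
/-- The formal power series `∑ᵢ xᵢ ^ k`. -/
def psumSeries (k : ℕ+) : MvPowerSeries ℕ ℚ :=
  fun m => if ∃ i, m = Finsupp.single i (k : ℕ) then 1 else 0

/-- The formal power series that is the sum of all monomials of degree `n`. -/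
def hsumSeries (n : ℕ) : MvPowerSeries ℕ ℚ :=
  fun m => if m.degree = n then 1 else 0

open Classical in
theorem coeff_psumSeries (k : ℕ+) (m : ℕ →₀ ℕ) : MvPowerSeries.coeff m (psumSeries k) =
    if ∃ i, m = Finsupp.single i (k : ℕ) then 1 else 0 := rfl

theorem coeff_hsumSeries (n : ℕ) (m : ℕ →₀ ℕ) : MvPowerSeries.coeff m (hsumSeries n) =
    if m.degree = n then 1 else 0 := rfl

theorem psumSeries_mem (k : ℕ+) : psumSeries k ∈ SymFun := by
  classical
  rw [mem_symFun_iff, rename_eq_iff]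
  refine ⟨fun ρ m => ?_, k, fun m hm => ?_⟩
  · rw [coeff_psumSeries, coeff_psumSeries]
    refine if_congr ?_ rfl rfl
    constructor
    · rintro ⟨i, hi⟩
      refine ⟨ρ.symm i, Finsupp.mapDomain_injective ρ.injective ?_⟩
      rw [hi, Finsupp.mapDomain_single, Equiv.apply_symm_apply]
    · rintro ⟨i, rfl⟩
      exact ⟨ρ i, Finsupp.mapDomain_single⟩
  · rw [coeff_psumSeries]
    refine if_neg ?_
    rintro ⟨i, rfl⟩
    simp at hm

theorem hsumSeries_mem (n : ℕ) : hsumSeries n ∈ SymFun := by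
  rw [mem_symFun_iff, rename_eq_iff]
  refine ⟨fun ρ m => ?_, n, fun m hm => ?_⟩
  · rw [coeff_hsumSeries, coeff_hsumSeries, Finsupp.degree_mapDomain]
  · rw [coeff_hsumSeries, if_neg hm.ne']

/-- The power sum symmetric function `p_k = ∑ᵢ xᵢ ^ k`, `k ≥ 1`. -/
def psum (k : ℕ+) : SymFun := ⟨psumSeries k, psumSeries_mem k⟩

/-- The complete homogeneous symmetric function `h_n`: the sum of all monomials of degree `n`. -/
def hsum (n : ℕ) : SymFun := ⟨hsumSeries n, hsumSeries_mem n⟩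

/-! ### `Λ` is the polynomial ring in the power sums -/

/-- A surjective endomorphism of a Noetherian commutative ring is injective. -/
theorem injective_of_surjective_ringEnd {R : Type*} [CommRing R] [IsNoetherianRing R]
    (f : R →+* R) (hf : Function.Surjective f) : Function.Injective f := by
  let K : ℕ →o Ideal R :=
    ⟨fun n => RingHom.ker (f ^ n), monotone_nat_of_le_succ fun n x hx => by
      rw [RingHom.mem_ker] at hx ⊢
      rw [pow_succ', RingHom.mul_def, RingHom.comp_apply, hx, map_zero]⟩
  obtain ⟨n, hn⟩ := monotone_stabilizes_iff_noetherian.mpr ‹IsNoetherianRing R› K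
  have hsurj : Function.Surjective (f ^ n) := by
    rw [RingHom.coe_pow]
    exact hf.iterate n
  rw [injective_iff_map_eq_zero]
  intro x hx
  obtain ⟨y, rfl⟩ := hsurj x
  have h1 : y ∈ K (n + 1) := by
    change (f ^ (n + 1)) y = 0
    rw [pow_succ', RingHom.mul_def, RingHom.comp_apply, hx]
  rw [← hn (n + 1) (Nat.le_succ n)] at h1
  exact h1

section Finite

variable (N : ℕ)

/-- The power sums `p₁, …, p_N` in `N` variables, as elements of the ring of symmetric
polynomials. -/
def finPsum (i : Fin N) : MvPolynomial.symmetricSubalgebra (Fin N) ℚ :=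
  ⟨MvPolynomial.psum (Fin N) ℚ (i + 1), MvPolynomial.psum_isSymmetric (Fin N) ℚ (i + 1)⟩

theorem esymm_mem_adjoin_psum (k : ℕ) (hk : k ≤ N) : MvPolynomial.esymm (Fin N) ℚ k ∈
    Algebra.adjoin ℚ (Set.range fun i : Fin N => MvPolynomial.psum (Fin N) ℚ (i + 1)) := by
  induction k using Nat.strong_induction_on with
  | _ k ih =>
  rcases Nat.eq_zero_or_pos k with rfl | hpos
  · rw [MvPolynomial.esymm_zero]
    exact one_mem _
  have hN := MvPolynomial.mul_esymm_eq_sum (Fin N) ℚ k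
  have hk0 : (k : ℚ) ≠ 0 := by exact_mod_cast hpos.ne'
  have : MvPolynomial.esymm (Fin N) ℚ k
      = (k : ℚ)⁻¹ • ((k : MvPolynomial (Fin N) ℚ) * MvPolynomial.esymm (Fin N) ℚ k) := by
    rw [← nsmul_eq_mul, ← Nat.cast_smul_eq_nsmul ℚ, smul_smul, inv_mul_cancel₀ hk0, one_smul]
  rw [this, hN]
  refine Subalgebra.smul_mem _ (mul_mem (pow_mem (neg_mem (one_mem _)) _) (sum_mem ?_)) _
  rintro ⟨a, b⟩ hab
  simp only [Finset.mem_filter, Finset.HasAntidiagonal.mem_antidiagonal] at hab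
  obtain ⟨hab, ha⟩ := hab
  refine mul_mem (mul_mem (pow_mem (neg_mem (one_mem _)) _) (ih a ha (by omega))) ?_
  refine Algebra.subset_adjoin ⟨⟨b - 1, by omega⟩, ?_⟩
  simp only
  rw [Nat.sub_add_cancel (by omega)]

theorem finPsum_surjective : Function.Surjective (MvPolynomial.aeval (R := ℚ) (finPsum N)) := by
  rw [← AlgHom.range_eq_top, ← Algebra.adjoin_range_eq_range_aeval, eq_top_iff]
  rintro x -
  obtain ⟨q, rfl⟩ := (MvPolynomial.esymmAlgEquiv (Fin N) ℚ (n := N) (by simp)).surjective x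
  have hmem : ∀ i : Fin N, (⟨MvPolynomial.esymm (Fin N) ℚ (i + 1),
      MvPolynomial.esymm_isSymmetric (Fin N) ℚ _⟩ : MvPolynomial.symmetricSubalgebra (Fin N) ℚ) ∈
      Algebra.adjoin ℚ (Set.range (finPsum N)) := by
    intro i
    have h := esymm_mem_adjoin_psum N (i + 1) i.2
    have hr : (Set.range fun i : Fin N => MvPolynomial.psum (Fin N) ℚ (i + 1)) =
        (MvPolynomial.symmetricSubalgebra (Fin N) ℚ).val '' Set.range (finPsum N) := by
      rw [← Set.range_comp]
      rfl
    rw [hr, ← AlgHom.map_adjoin] at h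
    obtain ⟨y, hy, hyx⟩ := h
    have hxy : y = ⟨MvPolynomial.esymm (Fin N) ℚ (i + 1),
      MvPolynomial.esymm_isSymmetric (Fin N) ℚ _⟩ := Subtype.ext hyx
    rw [← hxy]
    exact hy
  induction q using MvPolynomial.induction_on with
  | C a =>
    rw [← MvPolynomial.algebraMap_eq, AlgEquiv.commutes]
    exact Subalgebra.algebraMap_mem _ a
  | add p q hp hq =>
    rw [map_add]
    exact add_mem hp hq
  | mul_X p i hp =>
    rw [map_mul]
    refine mul_mem hp ?_
    rw [← MvPolynomial.esymmAlgEquiv_symm_apply ℚ (Fintype.card_fin N) i,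
      AlgEquiv.apply_symm_apply]
    exact hmem i

theorem finPsum_injective : Function.Injective (MvPolynomial.aeval (R := ℚ) (finPsum N)) := by
  have h := injective_of_surjective_ringEnd
    (((MvPolynomial.esymmAlgEquiv (Fin N) ℚ (n := N) (by simp)).symm.toAlgHom.comp
      (MvPolynomial.aeval (R := ℚ) (finPsum N))).toRingHom)
    ((MvPolynomial.esymmAlgEquiv (Fin N) ℚ (n := N) (by simp)).symm.surjective.comp
      (finPsum_surjective N))
  exact Function.Injective.of_comp
    (f := (MvPolynomial.esymmAlgEquiv (Fin N) ℚ (n := N) (by simp)).symm) h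

/-- Setting `x_i = 0` for `i ≥ N`. -/
def toFin : SymFun →ₐ[ℚ] MvPowerSeries (Fin N) ℚ :=
  (MvPowerSeries.killCompl (Fin.valEmbedding (n := N))).comp SymFun.val

theorem coeff_toFin (f : SymFun) (m : Fin N →₀ ℕ) : MvPowerSeries.coeff m (toFin N f) =
    MvPowerSeries.coeff (m.embDomain Fin.valEmbedding) (f : MvPowerSeries ℕ ℚ) := rfl

theorem toFin_psum (k : ℕ+) : toFin N (psum k) =
    (MvPolynomial.psum (Fin N) ℚ k : MvPowerSeries (Fin N) ℚ) := by
  classical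
  ext m
  rw [coeff_toFin, MvPolynomial.coeff_coe, MvPolynomial.psum, MvPolynomial.coeff_sum]
  change MvPowerSeries.coeff _ (psumSeries k) = _
  rw [coeff_psumSeries]
  simp only [MvPolynomial.coeff_X_pow]
  have hk : (k : ℕ) ≠ 0 := k.ne_zero
  by_cases h : ∃ i, m = Finsupp.single i (k : ℕ)
  · obtain ⟨i, rfl⟩ := h
    rw [if_pos ⟨i, by rw [Finsupp.embDomain_single]; rfl⟩,
      Finset.sum_eq_single i, if_pos rfl]
    · intro j _ hj
      rw [if_neg]
      intro h
      exact hj ((Finsupp.single_left_inj hk).mp h)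
    · simp
  · rw [if_neg, Finset.sum_eq_zero]
    · intro j _
      rw [if_neg]
      rintro rfl
      exact h ⟨j, rfl⟩
    · rintro ⟨i, hi⟩
      have hmem : i ∈ Set.range (Fin.valEmbedding (n := N)) := by
        by_contra hni
        have h1 := DFunLike.congr_fun hi i
        rw [Finsupp.embDomain_of_notMem_range _ _ _ hni, Finsupp.single_eq_same] at h1
        exact hk h1.symm
      obtain ⟨j, rfl⟩ := hmem
      rw [← Finsupp.embDomain_single] at hi
      exact h ⟨j, Finsupp.embDomain_injective _ hi⟩

/-- The index `i + 1` of the `i`-th power sum. -/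
def succIdx (i : Fin N) : ℕ+ := Nat.succPNat i

theorem toFin_aeval (q : MvPolynomial (Fin N) ℚ) :
    toFin N (MvPolynomial.aeval psum (MvPolynomial.rename (succIdx N) q)) =
      ((MvPolynomial.aeval (R := ℚ) (finPsum N) q : MvPolynomial (Fin N) ℚ) :
        MvPowerSeries (Fin N) ℚ) := by
  induction q using MvPolynomial.induction_on with
  | C a =>
    rw [MvPolynomial.rename_C, ← MvPolynomial.algebraMap_eq, ← MvPolynomial.algebraMap_eq,
      AlgHom.commutes, AlgHom.commutes, AlgHom.commutes]
    rw [Subalgebra.coe_algebraMap, MvPolynomial.algebraMap_eq, MvPolynomial.coe_C]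
    rfl
  | add p q hp hq =>
    simp only [map_add, hp, hq, Subalgebra.coe_add, MvPolynomial.coe_add]
  | mul_X p i hp =>
    simp only [map_mul, hp, MulMemClass.coe_mul, MvPolynomial.coe_mul, MvPolynomial.rename_X,
      MvPolynomial.aeval_X, toFin_psum]
    rfl

end Finite

theorem aeval_psum_injective : Function.Injective (MvPolynomial.aeval (R := ℚ) psum) := by
  rw [injective_iff_map_eq_zero]
  intro Q hQ
  obtain ⟨N, hN⟩ : ∃ N : ℕ, ∀ k ∈ Q.vars, (k : ℕ) ≤ N :=
    ⟨Q.vars.sup (fun k => (k : ℕ)), fun k hk => Finset.le_sup (f := fun k : ℕ+ => (k : ℕ)) hk⟩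
  have hinj : Function.Injective (succIdx N) := fun i j h =>
    Fin.ext (Nat.succPNat_injective h)
  obtain ⟨q, rfl⟩ := MvPolynomial.exists_rename_eq_of_vars_subset_range Q (succIdx N) hinj (by
    intro k hk
    refine ⟨⟨(k : ℕ) - 1, ?_⟩, PNat.eq ?_⟩
    · have := hN k hk
      have := k.pos
      omega
    · have := k.pos
      simp only [succIdx, Nat.succPNat_coe]
      omega)
  have h := toFin_aeval N q
  rw [hQ, map_zero] at h
  have h2 : MvPolynomial.aeval (R := ℚ) (finPsum N) q = 0 := by
    apply Subtype.ext
    apply MvPolynomial.coe_injective (Fin N) ℚ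
    rw [← h]
    simp
  rw [(injective_iff_map_eq_zero _).mp (finPsum_injective N) q h2, map_zero]

theorem exists_homogeneous (α : ℕ+ →₀ ℕ) (c : ℚ) : ∃ w : ℕ, ∀ m : ℕ →₀ ℕ,
    m.degree ≠ w → MvPowerSeries.coeff m
      (MvPolynomial.aeval psum (MvPolynomial.monomial α c) : MvPowerSeries ℕ ℚ) = 0 := by
  classical
  refine MvPolynomial.induction_on_monomial (motive := fun p => ∃ w : ℕ, ∀ m : ℕ →₀ ℕ,
    m.degree ≠ w → MvPowerSeries.coeff m
      (MvPolynomial.aeval psum p : MvPowerSeries ℕ ℚ) = 0) ?_ ?_ α c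
  · intro a
    refine ⟨0, fun m hm => ?_⟩
    rw [← MvPolynomial.algebraMap_eq, AlgHom.commutes, Subalgebra.coe_algebraMap,
      MvPowerSeries.algebraMap_apply, MvPowerSeries.coeff_C, if_neg]
    rintro rfl
    simp at hm
  · rintro p k ⟨w, hw⟩
    refine ⟨w + k, fun m hm => ?_⟩
    rw [map_mul, MvPolynomial.aeval_X, MulMemClass.coe_mul, MvPowerSeries.coeff_mul]
    refine Finset.sum_eq_zero fun x hx => ?_
    rw [Finset.HasAntidiagonal.mem_antidiagonal] at hx
    by_cases h1 : x.1.degree = w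
    · change _ * MvPowerSeries.coeff _ (psumSeries k) = 0
      rw [coeff_psumSeries, if_neg, mul_zero]
      rintro ⟨i, hi⟩
      apply hm
      rw [← hx, map_add, h1, hi, Finsupp.degree_single]
    · rw [hw _ h1, zero_mul]

theorem exists_truncation (N : ℕ) (Q : MvPolynomial ℕ+ ℚ) : ∃ Q' : MvPolynomial ℕ+ ℚ,
    ∀ m : ℕ →₀ ℕ, MvPowerSeries.coeff m (MvPolynomial.aeval psum Q' : MvPowerSeries ℕ ℚ) =
      if m.degree ≤ N then
        MvPowerSeries.coeff m (MvPolynomial.aeval psum Q : MvPowerSeries ℕ ℚ) else 0 := by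
  induction Q using MvPolynomial.induction_on' with
  | monomial α c =>
    obtain ⟨w, hw⟩ := exists_homogeneous α c
    by_cases h : w ≤ N
    · refine ⟨MvPolynomial.monomial α c, fun m => ?_⟩
      split_ifs with hm
      · rfl
      · exact hw m (by omega)
    · refine ⟨0, fun m => ?_⟩
      rw [map_zero, ZeroMemClass.coe_zero, map_zero]
      split_ifs with hm
      · exact (hw m (by omega)).symm
      · rfl
  | add p q hp hq =>
    obtain ⟨p', hp'⟩ := hp
    obtain ⟨q', hq'⟩ := hq
    refine ⟨p' + q', fun m => ?_⟩
    simp only [map_add, Subalgebra.coe_add, hp', hq']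
    split_ifs <;> simp

/-- Every monomial of degree at most `N` can be moved into the first `N` variables. -/
theorem exists_perm_embDomain (N : ℕ) (m : ℕ →₀ ℕ) (hm : m.degree ≤ N) :
    ∃ (ρ : Equiv.Perm ℕ) (m' : Fin N →₀ ℕ), m.mapDomain ρ = m'.embDomain Fin.valEmbedding := by
  have hcard : m.support.card ≤ N := by
    refine le_trans ?_ hm
    rw [Finsupp.degree_apply, Finset.card_eq_sum_ones]
    refine Finset.sum_le_sum fun i hi => ?_
    exact Nat.one_le_iff_ne_zero.mpr (Finsupp.mem_support_iff.mp hi)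
  have : MulAction.IsMultiplyPretransitive (Equiv.Perm ℕ) ℕ m.support.card :=
    Equiv.Perm.isMultiplyPretransitive ℕ _
  obtain ⟨ρ, hρ⟩ := this.exists_smul_eq
    (m.support.equivFin.symm.toEmbedding.trans (Function.Embedding.subtype _)) Fin.valEmbedding
  refine ⟨ρ, ?_⟩
  have : m.mapDomain ρ ∈ Set.range (Finsupp.embDomain (M := ℕ) (Fin.valEmbedding (n := N))) := by
    rw [Finsupp.mem_range_embDomain_iff]
    intro i hi
    have hi' := Finsupp.mapDomain_support hi
    rw [Finset.mem_image] at hi'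
    obtain ⟨j, hj, rfl⟩ := hi'
    have h1 := DFunLike.congr_fun hρ (m.support.equivFin ⟨j, hj⟩)
    simp at h1
    exact ⟨⟨_, lt_of_lt_of_le (m.support.equivFin ⟨j, hj⟩).2 hcard⟩, h1.symm⟩
  obtain ⟨m', h⟩ := this
  exact ⟨m', h.symm⟩

theorem aeval_psum_surjective : Function.Surjective (MvPolynomial.aeval (R := ℚ) psum) := by
  rintro ⟨f, hf⟩
  have hf' := hf
  obtain ⟨hsymm, N, hN⟩ := hf'
  rw [rename_eq_iff] at hsymm
  let g : MvPolynomial (Fin N) ℚ := MvPowerSeries.truncTotal (N + 1) (toFin N ⟨f, hf⟩)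
  have hg : (g : MvPowerSeries (Fin N) ℚ) = toFin N ⟨f, hf⟩ := by
    ext m
    rw [MvPolynomial.coeff_coe, MvPowerSeries.coeff_truncTotal_eq_ite]
    split_ifs with h
    · rfl
    · rw [coeff_toFin]
      refine (hN _ ?_).symm
      rw [Finsupp.embDomain_eq_mapDomain, Finsupp.degree_mapDomain]
      omega
  have hgs : g.IsSymmetric := by
    intro σ
    ext m
    obtain ⟨m, rfl⟩ : ∃ m', m = Finsupp.mapDomain σ m' := by
      refine ⟨m.mapDomain σ.symm, ?_⟩
      rw [← Finsupp.mapDomain_comp]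
      simp
    rw [MvPolynomial.coeff_rename_mapDomain σ σ.injective, ← MvPolynomial.coeff_coe,
      ← MvPolynomial.coeff_coe, hg, coeff_toFin, coeff_toFin,
      ← hsymm (σ.viaFintypeEmbedding Fin.valEmbedding)]
    congr 2
    rw [Finsupp.embDomain_eq_mapDomain, Finsupp.embDomain_eq_mapDomain, ← Finsupp.mapDomain_comp,
      ← Finsupp.mapDomain_comp]
    congr 1
    funext i
    exact σ.viaFintypeEmbedding_apply_image Fin.valEmbedding i
  obtain ⟨q, hq⟩ := finPsum_surjective N ⟨g, hgs⟩
  obtain ⟨Q, hQ⟩ := exists_truncation N (MvPolynomial.rename (succIdx N) q)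
  refine ⟨Q, Subtype.ext ?_⟩
  ext m
  rw [hQ]
  split_ifs with hm
  · obtain ⟨ρ, m', h⟩ := exists_perm_embDomain N m hm
    have h1 := (rename_eq_iff _).mp
      (MvPolynomial.aeval (R := ℚ) psum (MvPolynomial.rename (succIdx N) q)).2.1 ρ m
    rw [← h1, ← hsymm ρ m, h, ← coeff_toFin, toFin_aeval, hq]
    change MvPowerSeries.coeff m' (g : MvPowerSeries (Fin N) ℚ) = _
    rw [hg, coeff_toFin]
  · exact (hN m (by omega)).symm

/-- The ring `Λ` is the polynomial ring over `ℚ` in the power sums `p₁, p₂, …`. -/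
def psumEquiv : MvPolynomial ℕ+ ℚ ≃ₐ[ℚ] SymFun :=
  AlgEquiv.ofBijective (MvPolynomial.aeval psum) ⟨aeval_psum_injective, aeval_psum_surjective⟩

theorem psumEquiv_X (k : ℕ+) : psumEquiv (MvPolynomial.X k) = psum k :=
  MvPolynomial.aeval_X psum k

/-! ### Symmetric functions in two sets of variables -/

/-- `Λ(X, Y) = Λ(X) ⊗ Λ(Y)`, with `f(X)` embedded as `f ⊗ 1` and `f(Y)` as `1 ⊗ f`. -/
abbrev SymFunXY : Type := SymFun ⊗[ℚ] SymFun

/-- The ring `Λ(X, Y)` is the polynomial ring over `ℚ` in the power sums `p_k` of `X` (the indices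
`Sum.inl k`) and the power sums `p̃_k` of `Y` (the indices `Sum.inr k`). -/
def psumEquivXY : MvPolynomial (ℕ+ ⊕ ℕ+) ℚ ≃ₐ[ℚ] SymFunXY :=
  (MvPolynomial.tensorEquivSum ℚ ℕ+ ℕ+ ℚ).symm.trans
    (Algebra.TensorProduct.congr psumEquiv psumEquiv)

theorem psumEquivXY_inl (k : ℕ+) :
    psumEquivXY (MvPolynomial.X (Sum.inl k)) = psum k ⊗ₜ[ℚ] (1 : SymFun) := by
  have h : (MvPolynomial.X (Sum.inl k) : MvPolynomial (ℕ+ ⊕ ℕ+) ℚ) =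
      MvPolynomial.tensorEquivSum ℚ ℕ+ ℕ+ ℚ (MvPolynomial.X k ⊗ₜ 1) := by simp
  rw [h, psumEquivXY, AlgEquiv.trans_apply, AlgEquiv.symm_apply_apply]
  simp [psumEquiv_X]

theorem psumEquivXY_inr (k : ℕ+) :
    psumEquivXY (MvPolynomial.X (Sum.inr k)) = (1 : SymFun) ⊗ₜ[ℚ] psum k := by
  have h : (MvPolynomial.X (Sum.inr k) : MvPolynomial (ℕ+ ⊕ ℕ+) ℚ) =
      MvPolynomial.tensorEquivSum ℚ ℕ+ ℕ+ ℚ (1 ⊗ₜ MvPolynomial.X k) := by simp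
  rw [h, psumEquivXY, AlgEquiv.trans_apply, AlgEquiv.symm_apply_apply]
  simp [psumEquiv_X]

/-- The partial derivatives of `Λ(X, Y)`, viewed as the polynomial ring in the power sums:
`fatPderiv (Sum.inl k)` is `∂/∂p_k` and `fatPderiv (Sum.inr k)` is `∂/∂p̃_k`. -/
def fatPderiv (s : ℕ+ ⊕ ℕ+) : Derivation ℚ SymFunXY SymFunXY where
  toLinearMap := psumEquivXY.toLinearMap ∘ₗ (MvPolynomial.pderiv s).toLinearMap ∘ₗ
    psumEquivXY.symm.toLinearMap
  map_one_eq_zero' := by simp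
  leibniz' a b := by simp

/-- The ring `V` of formal power series over `ℚ` in the variables `p₁, p₂, …` (the indices
`Sum.inl k`) and `p̃₁, p̃₂, …` (the indices `Sum.inr k`). -/
abbrev V : Type := MvPowerSeries (ℕ+ ⊕ ℕ+) ℚ

/-- The algebra homomorphism `F : Λ(X, Y) → V` sending the power sums of `X` to the variables `p_k`
and those of `Y` to the variables `p̃_k`. -/
def specialize : SymFunXY →ₐ[ℚ] V :=
  (MvPolynomial.coeToMvPowerSeries.algHom ℚ).comp psumEquivXY.symm.toAlgHom

theorem specialize_psum_left (k : ℕ+) :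
    specialize (psum k ⊗ₜ[ℚ] (1 : SymFun)) = MvPowerSeries.X (Sum.inl k) := by
  rw [← psumEquivXY_inl]
  simp [specialize]

theorem specialize_psum_right (k : ℕ+) :
    specialize ((1 : SymFun) ⊗ₜ[ℚ] psum k) = MvPowerSeries.X (Sum.inr k) := by
  rw [← psumEquivXY_inr]
  simp [specialize]

/-! ### The operator `exp (∑ k ∂_k ∂̃_k)` -/

section Operators

variable {M : Type*} [AddCommGroup M] [Module ℚ M] (D D' : ℕ+ → Module.End ℚ M)

/-- The operator `∑_{k ≥ 1} k • D_k ∘ D'_k` (a sum with finitely many non-zero terms at each vector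
of its domain). -/
def mixedSum (f : M) : M := ∑ᶠ k : ℕ+, (k : ℚ) • D k (D' k f)

/-- The operator `exp (∑_{k ≥ 1} k • D_k ∘ D'_k) = ∑ₙ (1 / n!) (∑_{k ≥ 1} k • D_k ∘ D'_k) ^ n`. -/
def expMixedSum (f : M) : M := ∑ᶠ n : ℕ, (n.factorial : ℚ)⁻¹ • (mixedSum D D')^[n] f

/-- The vector `f` is in the domain of `exp (∑_{k ≥ 1} k • D_k ∘ D'_k)`: all the sums in the
definition of its image have only finitely many non-zero terms. -/
def ExpMixedSumFinite (f : M) : Prop :=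
  (∀ n : ℕ, {k : ℕ+ | D k (D' k ((mixedSum D D')^[n] f)) ≠ 0}.Finite) ∧
    {n : ℕ | (mixedSum D D')^[n] f ≠ 0}.Finite

end Operators

/-- The operator `∂/∂p_k` of `V`. -/
def dP (k : ℕ+) : Module.End ℚ V := (MvPowerSeries.pderiv ℚ (Sum.inl k)).toLinearMap

/-- The operator `∂/∂p̃_k` of `V`. -/
def dPt (k : ℕ+) : Module.End ℚ V := (MvPowerSeries.pderiv ℚ (Sum.inr k)).toLinearMap

/-- The operator `∂/∂p_k` of `Λ(X, Y)`. -/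
def fatDP (k : ℕ+) : Module.End ℚ SymFunXY := (fatPderiv (Sum.inl k)).toLinearMap

/-- The operator `∂/∂p̃_k` of `Λ(X, Y)`. -/
def fatDPt (k : ℕ+) : Module.End ℚ SymFunXY := (fatPderiv (Sum.inr k)).toLinearMap

/-- The operator `Δ = exp (∑ k ∂/∂p_k ∂/∂p̃_k)` of `V`. -/
def Delta : V → V := expMixedSum dP dPt

/-- The operator `Δ = exp (∑ k ∂/∂p_k ∂/∂p̃_k)` of `Λ(X, Y)`. -/
def fatDelta : SymFunXY → SymFunXY := expMixedSum fatDP fatDPt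

/-! ### The Tracy–Widom determinants -/

/-- `h_n` for an integer index `n`, with `h_n = 0` for `n < 0`. -/
def hInt (n : ℤ) : SymFun := if 0 ≤ n then hsum n.toNat else 0

/-- The `d × ∞` matrix with entries `h̃_{i - j + μ_{d - i + 1}}` (for `i, j ≥ 1`). Rows, columns
and parts are numbered from `0` here, which turns `μ_{d - i + 1}` into `μ.rowLen i.rev`. -/
def twLeft (d : ℕ) (μ : YoungDiagram) : Matrix (Fin d) ℕ SymFunXY :=
  Matrix.of fun i j => (1 : SymFun) ⊗ₜ[ℚ] hInt ((i : ℤ) - (j : ℤ) + (μ.rowLen i.rev : ℤ))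

/-- The `∞ × d` matrix with entries `h_{j - i + λ_{d - j + 1}}` (for `i, j ≥ 1`). -/
def twRight (d : ℕ) (lam : YoungDiagram) : Matrix ℕ (Fin d) SymFunXY :=
  Matrix.of fun i j => hInt ((j : ℤ) - (i : ℤ) + (lam.rowLen j.rev : ℤ)) ⊗ₜ[ℚ] (1 : SymFun)

/-- The Tracy–Widom determinant of the partitions `λ` and `μ` (given by their Young diagrams) in
`Λ(X, Y)`: the determinant of the product of the two matrices above, for an integer `d` that is at
least the lengths of `λ` and `μ`. -/
def fatTW (d : ℕ) (lam μ : YoungDiagram) : SymFunXY :=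
  Matrix.det (Matrix.of fun i j : Fin d => ∑ᶠ k : ℕ, twLeft d μ i k * twRight d lam k j)

/-- The Tracy–Widom determinant in `V`. -/
def TW (d : ℕ) (lam μ : YoungDiagram) : V := specialize (fatTW d lam μ)

end TracyWidom

end

/-!
The proof takes place in the polynomial ring `PolyXY` in the power sums `p_k`, `p̃_k`, to which
`psumEquivXY` and the inclusion of polynomials into power series reduce both halves of the theorem
(`Intertwines`). There the statement says that `exp (∑ k ∂_k ∂̃_k)` sends `s_λ(X) s_μ(Y)` to the
determinant `TW^{λμ}`: the left (right) factor of the matrix product is unitriangular if `μ` (`λ`)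
is empty, so that `TW^{λ∅}` and `TW^{∅μ}` are the Jacobi–Trudi determinants of `s_λ(X)` and
`s_μ(Y)` (`fatTW_bot_right`, `fatTW_bot_left`), which do not depend on their size `d`
(`schurDet_shiftedPart`).

Take variables `x_1, …, x_d` and let `H(x) = ∏_j ∑_n h_n x_j ^ n`. Conjugation by the exponential
turns multiplication by `p̃_k` into multiplication by `p̃_k` plus `k ∂_k`
(`expEnd_apply_of_commutator`), and `k ∂_k H(x) = (∑_j x_j ^ k) H(x)`, a consequence of
Newton's identity `n h_n = ∑ p_k h_{n - k}` (`IsNewtonPair.derivation_coeff`). Hence, for every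
`g ∈ Λ(Y)`, the exponential sends `H(x) g` to `H(x) g(Y, x)`, where the `x_j` were added to the
alphabet `Y` (`polyExp_mul_hProd`). Only the coefficients of this identity at monomials `x ^ b` are
needed, so that polynomials in the `x_j` and the linear map `coeffH b` suffice.

With `b_j = j + λ_{d - j}` and `a_i = i + μ_{d - i}`, `s_λ` is the coefficient of `x ^ b` in
`H(x) det (x_j ^ i)`, and so the image of `s_λ(X) s_μ(Y)` is the coefficient of `x ^ b` in
`H(x) det (x_j ^ i) s_μ(Y, x)`. The generating series of the `h_n(Y, x)` is that of the `h̃_n` times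
`∏_j 1 / (1 - x_j t)` (`map_addVars_hsumGen`), and the product of the last two factors is the
determinant of `∑_k h̃_{a_i - k} x_j ^ k` (`det_coeff_mul_det_vandermonde`). Column `j` involves only
`x_j`, so the coefficient can be taken column by column, which gives the determinant of
`∑_k h̃_{a_i - k} h_{b_j - k}`, that is, `TW^{λμ}` (`polyExp_schurDet`).
-/

open scoped TensorProduct

noncomputable section

namespace TracyWidom

/-! ### Newton pairs of power series -/

section NewtonPair

open PowerSeries

variable {R : Type*} [CommRing R]

/-- The relation `t · h'(t) = p(t) h(t)`, `h(0) = 1`, between the generating series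
`p = ∑_{k ≥ 1} p_k t ^ k` of the power sums and the generating series `h = ∑ h_n t ^ n` of the
complete homogeneous symmetric functions. -/
def IsNewtonPair (p h : R⟦X⟧) : Prop :=
  constantCoeff h = 1 ∧ X * derivative R h = p * h

theorem coeff_X_mul_derivative (f : R⟦X⟧) (n : ℕ) :
    coeff n (X * derivative R f) = n * coeff n f := by
  cases n with
  | zero => simp
  | succ n => rw [coeff_succ_X_mul, coeff_derivative]; push_cast; ring

theorem IsNewtonPair.constantCoeff_eq_zero {p h : R⟦X⟧} (H : IsNewtonPair p h) :
    constantCoeff p = 0 := by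
  have := congrArg constantCoeff H.2
  rw [map_mul, map_mul, H.1, constantCoeff_X, zero_mul, mul_one] at this
  exact this.symm

/-- The coefficients of a solution of `t f' = p f`, `p(0) = 0`, are determined recursively by its
constant term, since `n` is invertible for `n ≥ 1`. -/
theorem eq_zero_of_X_mul_derivative [Algebra ℚ R] {p f : R⟦X⟧} (hp : constantCoeff p = 0)
    (hf : constantCoeff f = 0) (H : X * derivative R f = p * f) : f = 0 := by
  ext n
  induction n using Nat.strong_induction_on with
  | _ n ih =>
  rcases Nat.eq_zero_or_pos n with rfl | hn
  · simpa using hf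
  have h := congrArg (coeff n) H
  rw [coeff_X_mul_derivative, coeff_mul, Finset.sum_eq_zero] at h
  · have hu : IsUnit (n : R) := by
      have : IsUnit (algebraMap ℚ R n) :=
        (IsUnit.mk0 (n : ℚ) (by exact_mod_cast hn.ne')).map (algebraMap ℚ R)
      rwa [map_natCast] at this
    rw [map_zero]
    exact hu.mul_right_eq_zero.mp h
  · rintro ⟨i, j⟩ hij
    rw [Finset.HasAntidiagonal.mem_antidiagonal] at hij
    rcases Nat.eq_zero_or_pos i with hi | hi
    · simp only [hi, coeff_zero_eq_constantCoeff, hp, zero_mul]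
    · simp only at hij ⊢
      rw [ih j (by omega), map_zero, mul_zero]

theorem IsNewtonPair.unique [Algebra ℚ R] {p h h' : R⟦X⟧} (H : IsNewtonPair p h)
    (H' : IsNewtonPair p h') : h = h' := by
  rw [← sub_eq_zero]
  refine eq_zero_of_X_mul_derivative H.constantCoeff_eq_zero ?_ ?_
  · rw [map_sub, H.1, H'.1, sub_self]
  · rw [map_sub, mul_sub, mul_sub, H.2, H'.2]

theorem IsNewtonPair.one : IsNewtonPair (0 : R⟦X⟧) 1 := by
  refine ⟨map_one _, ?_⟩
  rw [derivative_one, mul_zero, zero_mul]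

theorem IsNewtonPair.mul {p h q g : R⟦X⟧} (H : IsNewtonPair p h) (H' : IsNewtonPair q g) :
    IsNewtonPair (p + q) (h * g) := by
  refine ⟨by rw [map_mul, H.1, H'.1, one_mul], ?_⟩
  rw [Derivation.leibniz, smul_eq_mul, smul_eq_mul]
  linear_combination g * H.2 + h * H'.2

theorem IsNewtonPair.prod {ι : Type*} (s : Finset ι) {p h : ι → R⟦X⟧}
    (H : ∀ i ∈ s, IsNewtonPair (p i) (h i)) :
    IsNewtonPair (∑ i ∈ s, p i) (∏ i ∈ s, h i) := by
  classical
  induction s using Finset.induction_on with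
  | empty => exact .one
  | insert a s ha ih =>
    rw [Finset.sum_insert ha, Finset.prod_insert ha]
    exact (H a (Finset.mem_insert_self a s)).mul
      (ih fun i hi => H i (Finset.mem_insert_of_mem hi))

theorem IsNewtonPair.map {S : Type*} [CommRing S] (φ : R →+* S) {p h : R⟦X⟧}
    (H : IsNewtonPair p h) : IsNewtonPair (PowerSeries.map φ p) (PowerSeries.map φ h) := by
  refine ⟨?_, ?_⟩
  · rw [← coeff_zero_eq_constantCoeff_apply, coeff_map, coeff_zero_eq_constantCoeff_apply, H.1,
      map_one]
  · ext n
    rw [coeff_X_mul_derivative, ← map_mul, coeff_map, coeff_map, ← H.2, coeff_X_mul_derivative,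
      map_mul, map_natCast]

/-- The geometric series `∑ (x t) ^ n`. -/
def geomSeries (x : R) : R⟦X⟧ := mk (x ^ ·)

theorem geomSeries_mul_one_sub (x : R) : geomSeries x * (1 - C x * X) = 1 := by
  ext n
  rw [mul_sub, mul_one, map_sub, ← mul_assoc]
  cases n with
  | zero => simp [geomSeries]
  | succ n =>
    rw [coeff_succ_mul_X, coeff_mul_C, geomSeries, coeff_mk, coeff_mk, coeff_one,
      if_neg n.succ_ne_zero, pow_succ, sub_self]

theorem isNewtonPair_geomSeries (x : R) :
    IsNewtonPair (mk fun k => if k = 0 then 0 else x ^ k) (geomSeries x) := by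
  refine ⟨?_, ?_⟩
  · rw [← coeff_zero_eq_constantCoeff_apply, geomSeries, coeff_mk, pow_zero]
  · ext n
    have h : ∀ a ∈ Finset.HasAntidiagonal.antidiagonal n,
        (if a.1 = 0 then 0 else x ^ a.1) * x ^ a.2 = if a.1 = 0 then 0 else x ^ n := by
      intro a ha
      rw [Finset.HasAntidiagonal.mem_antidiagonal] at ha
      split_ifs
      · rw [zero_mul]
      · rw [← pow_add, ha]
    rw [coeff_X_mul_derivative, coeff_mul, geomSeries]
    simp only [coeff_mk]
    rw [Finset.sum_congr rfl h, Finset.Nat.sum_antidiagonal_eq_sum_range_succ_mk,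
      Finset.sum_range_succ']
    simp

/-- The derivation `k ∂/∂p_k` sends `h_n` to `h_{n - k}`: applied coefficientwise to Newton's
identity it shows that `∑ D(h_n) t ^ n` and `t ^ k h` solve the same inhomogeneous linear
differential equation, with the same constant term `0`. -/
theorem IsNewtonPair.derivation_coeff [Algebra ℚ R] {p h : R⟦X⟧} (H : IsNewtonPair p h)
    (D : Derivation ℚ R R) (k : ℕ) (hk : k ≠ 0)
    (hD : ∀ j, D (coeff j p) = if j = k then (k : R) else 0) (n : ℕ) :
    D (coeff n h) = coeff n (X ^ k * h) := by
  have hc : (mk fun n => D (coeff n h)) - X ^ k * h = 0 := by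
    refine eq_zero_of_X_mul_derivative H.constantCoeff_eq_zero ?_ ?_
    · rw [map_sub, ← coeff_zero_eq_constantCoeff_apply, coeff_mk,
        coeff_zero_eq_constantCoeff_apply, H.1, map_mul, map_pow, constantCoeff_X, zero_pow hk,
        zero_mul, sub_zero, ← map_one (algebraMap ℚ R), D.map_algebraMap]
    · have h1 : X * derivative R (mk fun n => D (coeff n h)) =
          C (k : R) * X ^ k * h + p * mk fun n => D (coeff n h) := by
        ext n
        have h2 := congrArg D (congrArg (coeff n) H.2)
        rw [coeff_X_mul_derivative, coeff_mul, map_sum] at h2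
        simp only [Derivation.leibniz, smul_eq_mul, hD, Derivation.map_natCast, mul_zero,
          add_zero] at h2
        rw [coeff_X_mul_derivative, coeff_mk, h2, map_add, coeff_mul, coeff_mul,
          ← Finset.sum_add_distrib]
        refine Finset.sum_congr rfl fun a _ => ?_
        rw [coeff_C_mul, coeff_X_pow, coeff_mk]
        split_ifs <;> ring
      have h3 : X * derivative R (X ^ k * h) = C (k : R) * X ^ k * h + p * (X ^ k * h) := by
        rw [Derivation.leibniz, derivative_pow, smul_eq_mul, smul_eq_mul, derivative_X, map_natCast]
        obtain ⟨l, rfl⟩ := Nat.exists_eq_succ_of_ne_zero hk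
        rw [Nat.succ_eq_add_one, Nat.add_sub_cancel]
        linear_combination X ^ (l + 1) * H.2
      rw [map_sub, mul_sub, h1, h3]
      ring
  have := congrArg (coeff n) (sub_eq_zero.mp hc)
  rwa [coeff_mk] at this

end NewtonPair

/-! ### Newton's identity in the ring of symmetric functions -/

/-- The generating series of the power sums, as variables of a polynomial ring. -/
def psumGen : PowerSeries (MvPolynomial ℕ+ ℚ) :=
  PowerSeries.mk fun k => if hk : 0 < k then MvPolynomial.X (k.toPNat hk) else 0

/-- The generating series of the complete homogeneous symmetric functions, as polynomials in the
power sums. -/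
def hsumGen : PowerSeries (MvPolynomial ℕ+ ℚ) :=
  PowerSeries.mk fun n => psumEquiv.symm (hsum n)

/-- Comparing coefficients of a monomial `m` of degree `n` in `∑ p_k h_{n - k}`: the product
`p_k h_{n - k}` contributes the number of variables whose exponent in `m` is at least `k`, and
these numbers add up to `n`. -/
theorem sum_psum_mul_hsum (n : ℕ) :
    ∑ a ∈ Finset.HasAntidiagonal.antidiagonal n,
        (if hk : 0 < a.1 then psum (a.1.toPNat hk) else 0) * hsum a.2 =
      (n : SymFun) * hsum n := by
  classical
  have key : ∀ (k l : ℕ) (m : ℕ →₀ ℕ), k + l = n →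
      MvPowerSeries.coeff m (((if hk : 0 < k then psum (k.toPNat hk) else 0) * hsum l : SymFun) :
        MvPowerSeries ℕ ℚ) =
      if m.degree = n then ∑ i ∈ m.support, if 0 < k ∧ k ≤ m i then 1 else 0 else 0 := by
    intro k l m hkl
    by_cases hk : 0 < k
    · rw [dif_pos hk, MulMemClass.coe_mul, MvPowerSeries.coeff_mul]
      change ∑ x ∈ Finset.HasAntidiagonal.antidiagonal m,
        MvPowerSeries.coeff x.1 (psumSeries (k.toPNat hk)) *
        MvPowerSeries.coeff x.2 (hsumSeries l) = _
      simp only [coeff_psumSeries, coeff_hsumSeries,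
        show ((k.toPNat hk : ℕ+) : ℕ) = k from rfl, ite_mul, one_mul, zero_mul]
      by_cases hm : m.degree = n
      · simp only [hk, true_and]
        rw [if_pos hm, ← Finset.sum_filter, ← Finset.sum_filter (s := m.support)]
        refine (Finset.sum_bij (fun i _ => (Finsupp.single i k, m - Finsupp.single i k))
          ?_ ?_ ?_ ?_).symm
        · intro i hi
          have hi := (Finset.mem_filter.mp hi).2
          rw [Finset.mem_filter, Finset.HasAntidiagonal.mem_antidiagonal]
          exact ⟨add_tsub_cancel_of_le (Finsupp.single_le_iff.mpr hi), i, rfl⟩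
        · intro i _ j _ hij
          exact (Finsupp.single_left_inj hk.ne').mp (Prod.ext_iff.mp hij).1
        · rintro ⟨a, b⟩ hab
          rw [Finset.mem_filter, Finset.HasAntidiagonal.mem_antidiagonal] at hab
          obtain ⟨hab, i, rfl⟩ := hab
          have h1 : k ≤ m i := by
            have := DFunLike.congr_fun hab i
            simp at this
            omega
          refine ⟨i, ?_, ?_⟩
          · rw [Finset.mem_filter, Finsupp.mem_support_iff]
            exact ⟨by omega, h1⟩
          · simp only at hab
            rw [← hab, add_tsub_cancel_left]
        · intro i hi
          have hi := (Finset.mem_filter.mp hi).2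
          have h1 := congrArg Finsupp.degree
            (add_tsub_cancel_of_le (Finsupp.single_le_iff.mpr hi))
          rw [map_add, Finsupp.degree_single, hm] at h1
          rw [if_pos]
          simp only
          omega
      · rw [if_neg hm]
        refine Finset.sum_eq_zero ?_
        rintro ⟨a, b⟩ hab
        rw [Finset.HasAntidiagonal.mem_antidiagonal] at hab
        split_ifs with h1 h2
        · exfalso
          obtain ⟨i, hi⟩ := h1
          simp only at hi h2
          apply hm
          rw [← hab, map_add, hi, Finsupp.degree_single, h2, hkl]
        · rfl
        · rfl
    · rw [dif_neg hk, zero_mul, ZeroMemClass.coe_zero, map_zero]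
      simp [hk]
  apply Subtype.ext
  ext m
  rw [AddSubmonoidClass.coe_finsetSum, map_sum]
  rw [Finset.sum_congr rfl fun a ha => key a.1 a.2 m
    (Finset.HasAntidiagonal.mem_antidiagonal.mp ha)]
  have hr : MvPowerSeries.coeff m (((n : SymFun) * hsum n : SymFun) : MvPowerSeries ℕ ℚ) =
      if m.degree = n then (n : ℚ) else 0 := by
    rw [← nsmul_eq_mul, AddSubmonoidClass.coe_nsmul, map_nsmul, nsmul_eq_mul]
    change (n : ℚ) * MvPowerSeries.coeff m (hsumSeries n) = _
    rw [coeff_hsumSeries, mul_ite, mul_one, mul_zero]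
  rw [hr]
  split_ifs with hm
  · rw [Finset.sum_comm, ← hm, Finsupp.degree_apply, Nat.cast_sum]
    refine Finset.sum_congr rfl fun i hi => ?_
    have hle : m i ≤ n := hm ▸ Finsupp.le_degree i m
    rw [← Finsupp.degree_apply, hm, Finset.Nat.sum_antidiagonal_eq_sum_range_succ_mk]
    simp only
    rw [← Finset.sum_filter, Finset.sum_const, nsmul_eq_mul, mul_one]
    congr 1
    have : (Finset.range n.succ).filter (fun k => 0 < k ∧ k ≤ m i) = Finset.Icc 1 (m i) := by
      ext k
      simp only [Finset.mem_filter, Finset.mem_range, Finset.mem_Icc]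
      omega
    rw [this, Nat.card_Icc, Nat.add_sub_cancel]
  · exact Finset.sum_const_zero

theorem hsum_zero : hsum 0 = 1 := by
  classical
  apply Subtype.ext
  ext m
  change MvPowerSeries.coeff m (hsumSeries 0) = MvPowerSeries.coeff m 1
  rw [coeff_hsumSeries, MvPowerSeries.coeff_one]
  simp only [Finsupp.degree_eq_zero_iff]

theorem isNewtonPair_gen : IsNewtonPair psumGen hsumGen := by
  refine ⟨?_, ?_⟩
  · rw [← PowerSeries.coeff_zero_eq_constantCoeff_apply, hsumGen, PowerSeries.coeff_mk, hsum_zero,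
      map_one]
  · ext1 n
    rw [coeff_X_mul_derivative, PowerSeries.coeff_mul, hsumGen, psumGen]
    simp only [PowerSeries.coeff_mk]
    apply psumEquiv.injective
    rw [map_mul, map_natCast, AlgEquiv.apply_symm_apply, map_sum, ← sum_psum_mul_hsum]
    refine Finset.sum_congr rfl fun a _ => ?_
    rw [map_mul, AlgEquiv.apply_symm_apply]
    split_ifs
    · rw [psumEquiv_X]
    · rw [map_zero]

/-! ### Exponentials of locally nilpotent operators -/

section Exponential

variable {M : Type*} [AddCommGroup M] [Module ℚ M]

/-- The vector `exp (T) f = ∑ (1 / n!) T ^ n f`; it is meaningful for those `f` that are killed by a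
power of `T`. -/
def expEnd (T : Module.End ℚ M) (f : M) : M := ∑ᶠ n : ℕ, (n.factorial : ℚ)⁻¹ • (T ^ n) f

theorem pow_apply_eq_zero_of_le {T : Module.End ℚ M} {f : M} {N n : ℕ} (h : (T ^ N) f = 0)
    (hn : N ≤ n) : (T ^ n) f = 0 := by
  obtain ⟨k, rfl⟩ := Nat.exists_eq_add_of_le hn
  rw [add_comm, pow_add, Module.End.mul_apply, h, map_zero]

theorem expEnd_eq_sum {T : Module.End ℚ M} {f : M} {N : ℕ} (h : (T ^ N) f = 0) :
    expEnd T f = ∑ n ∈ Finset.range N, (n.factorial : ℚ)⁻¹ • (T ^ n) f := by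
  refine finsum_eq_sum_of_support_subset _ fun n hn => ?_
  rw [Function.mem_support] at hn
  rw [Finset.coe_range, Set.mem_Iio]
  by_contra hN
  exact hn (by rw [pow_apply_eq_zero_of_le h (not_lt.mp hN), smul_zero])

/-- If `c = [T, a]` commutes with `T`, then `[T ^ (n + 1), a] = (n + 1) c T ^ n`. -/
theorem pow_succ_apply_of_commutator {T a c : Module.End ℚ M} (hac : T * a = a * T + c)
    (hTc : T * c = c * T) (n : ℕ) (f : M) :
    (T ^ (n + 1)) (a f) = a ((T ^ (n + 1)) f) + ((n + 1 : ℕ) : ℚ) • c ((T ^ n) f) := by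
  have h : ∀ n : ℕ, T ^ (n + 1) * a = a * T ^ (n + 1) + ((n + 1 : ℕ) : ℚ) • (c * T ^ n) := by
    intro n
    induction n with
    | zero => simp [hac]
    | succ n ih =>
      rw [pow_succ' T (n + 1), mul_assoc, ih, mul_add, mul_smul_comm, ← mul_assoc, hac,
        ← mul_assoc T c, hTc, mul_assoc c T, ← pow_succ', add_mul, mul_assoc a, ← pow_succ',
        add_assoc]
      push_cast
      module
  have := LinearMap.congr_fun (h n) f
  simpa using this

theorem pow_succ_apply_eq_zero {T a c : Module.End ℚ M} (hac : T * a = a * T + c)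
    (hTc : T * c = c * T) {N : ℕ} {f : M} (h : (T ^ N) f = 0) : (T ^ (N + 1)) (a f) = 0 := by
  rw [pow_succ_apply_of_commutator hac hTc, h, pow_apply_eq_zero_of_le h N.le_succ, map_zero,
    map_zero, smul_zero, add_zero]

/-- Conjugation by `exp T` turns `a` into `a + c` if `c = [T, a]` commutes with `T`. -/
theorem expEnd_apply_of_commutator {T a c : Module.End ℚ M} (hac : T * a = a * T + c)
    (hTc : T * c = c * T) {N : ℕ} {f : M} (h : (T ^ N) f = 0) :
    expEnd T (a f) = a (expEnd T f) + c (expEnd T f) := by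
  rw [expEnd_eq_sum (pow_succ_apply_eq_zero hac hTc h), Finset.sum_range_succ']
  have h1 : ∀ n ∈ Finset.range N, (((n + 1).factorial : ℕ) : ℚ)⁻¹ • (T ^ (n + 1)) (a f) =
      a ((((n + 1).factorial : ℕ) : ℚ)⁻¹ • (T ^ (n + 1)) f) +
        c ((n.factorial : ℚ)⁻¹ • (T ^ n) f) := by
    intro n _
    rw [pow_succ_apply_of_commutator hac hTc, smul_add, map_smul, map_smul, smul_smul,
      Nat.factorial_succ]
    congr 2
    push_cast
    have h2 : (n : ℚ) + 1 ≠ 0 := by positivity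
    have h3 : (n.factorial : ℚ) ≠ 0 := by positivity
    field_simp
  rw [Finset.sum_congr rfl h1, Finset.sum_add_distrib, add_right_comm]
  congr 1
  · rw [expEnd_eq_sum (pow_apply_eq_zero_of_le h N.le_succ), Finset.sum_range_succ', map_add,
      map_sum]
    simp
  · rw [expEnd_eq_sum h, map_sum]

end Exponential

/-! ### The operator `exp (∑ k ∂_k ∂̃_k)` on polynomials in two families of variables -/

section Polynomial

open MvPolynomial

/-- Polynomials over `ℚ` in the variables `p_k` (the indices `Sum.inl k`) and `p̃_k` (the indices
`Sum.inr k`). -/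
abbrev PolyXY : Type := MvPolynomial (ℕ+ ⊕ ℕ+) ℚ

/-- The operator `∂/∂p_k` on polynomials. -/
def polyDP (k : ℕ+) : Module.End ℚ PolyXY := (pderiv (Sum.inl k)).toLinearMap

/-- The operator `∂/∂p̃_k` on polynomials. -/
def polyDPt (k : ℕ+) : Module.End ℚ PolyXY := (pderiv (Sum.inr k)).toLinearMap

theorem finite_polyDP_polyDPt (f : PolyXY) : {k : ℕ+ | polyDP k (polyDPt k f) ≠ 0}.Finite := by
  refine ((Finset.finite_toSet f.vars).preimage Sum.inr_injective.injOn).subset fun k hk => ?_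
  rw [Set.mem_preimage, Finset.mem_coe]
  by_contra hv
  refine hk ?_
  rw [show polyDPt k f = 0 from pderiv_eq_zero_of_notMem_vars hv, map_zero]

theorem finite_support_smul_polyDP_polyDPt (f : PolyXY) :
    (Function.support fun k : ℕ+ => (k : ℚ) • polyDP k (polyDPt k f)).Finite := by
  refine (finite_polyDP_polyDPt f).subset fun k hk => ?_
  rw [Function.mem_support] at hk
  intro h
  exact hk (by rw [h, smul_zero])

/-- The operator `∑ k ∂_k ∂̃_k` on polynomials, as a linear map. -/
def polyMixedSum : Module.End ℚ PolyXY where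
  toFun := mixedSum polyDP polyDPt
  map_add' f g := by
    rw [mixedSum, mixedSum, mixedSum, ← finsum_add_distrib (finite_support_smul_polyDP_polyDPt f)
      (finite_support_smul_polyDP_polyDPt g)]
    simp only [map_add, smul_add]
  map_smul' c f := by
    rw [mixedSum, mixedSum, RingHom.id_apply, smul_finsum]
    simp only [map_smul, smul_comm c]

theorem polyMixedSum_apply (f : PolyXY) : polyMixedSum f = mixedSum polyDP polyDPt f := rfl

theorem pow_polyMixedSum_apply (n : ℕ) (f : PolyXY) :
    (polyMixedSum ^ n) f = (mixedSum polyDP polyDPt)^[n] f := by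
  rw [Module.End.pow_apply]
  rfl

theorem pderiv_comm (s t : ℕ+ ⊕ ℕ+) (f : PolyXY) :
    pderiv s (pderiv t f) = pderiv t (pderiv s f) := by
  have h : ⁅pderiv (R := ℚ) s, pderiv (R := ℚ) t⁆ = 0 := by
    refine MvPolynomial.derivation_ext fun i => ?_
    classical
    rw [Derivation.commutator_apply, pderiv_X, pderiv_X, Pi.single_apply, Pi.single_apply]
    split_ifs <;> simp
  have := DFunLike.congr_fun h f
  rw [Derivation.commutator_apply, Derivation.zero_apply, sub_eq_zero] at this
  exact this

theorem polyMixedSum_mul_pderiv (s : ℕ+ ⊕ ℕ+) :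
    polyMixedSum * (pderiv s).toLinearMap = (pderiv s).toLinearMap * polyMixedSum := by
  refine LinearMap.ext fun f => ?_
  rw [Module.End.mul_apply, Module.End.mul_apply, polyMixedSum_apply, polyMixedSum_apply, mixedSum,
    mixedSum]
  have := (pderiv (R := ℚ) s).toLinearMap.toAddMonoidHom.map_finsum
    (finite_support_smul_polyDP_polyDPt f)
  refine Eq.trans ?_ this.symm
  refine finsum_congr fun k => ?_
  change (k : ℚ) • pderiv _ (pderiv _ (pderiv s f)) = pderiv s ((k : ℚ) • pderiv _ (pderiv _ f))
  rw [Derivation.map_smul, pderiv_comm (Sum.inr k) s, pderiv_comm (Sum.inl k) s]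

theorem polyMixedSum_mul_mulLeft_inr (k : ℕ+) :
    polyMixedSum * LinearMap.mulLeft ℚ (X (Sum.inr k)) =
      LinearMap.mulLeft ℚ (X (Sum.inr k)) * polyMixedSum + (k : ℚ) • polyDP k := by
  refine LinearMap.ext fun f => ?_
  rw [Module.End.mul_apply, LinearMap.add_apply, Module.End.mul_apply, LinearMap.smul_apply,
    LinearMap.mulLeft_apply, LinearMap.mulLeft_apply, polyMixedSum_apply, polyMixedSum_apply,
    mixedSum, mixedSum]
  have h : ∀ l : ℕ+, (l : ℚ) • polyDP l (polyDPt l (X (Sum.inr k) * f)) =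
      X (Sum.inr k) * ((l : ℚ) • polyDP l (polyDPt l f)) +
        if l = k then (k : ℚ) • polyDP k f else 0 := by
    intro l
    change (l : ℚ) • pderiv _ (pderiv _ _) = _ * ((l : ℚ) • pderiv _ (pderiv _ _)) +
      if l = k then (k : ℚ) • pderiv _ f else 0
    rw [pderiv_mul]
    split_ifs with hl
    · rw [hl, pderiv_X_self, one_mul, map_add, pderiv_mul, pderiv_X_of_ne (by simp), zero_mul,
        zero_add, smul_add, mul_smul_comm, add_comm]
    · rw [pderiv_X_of_ne (by simpa using Ne.symm hl), zero_mul, zero_add, pderiv_mul,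
        pderiv_X_of_ne (by simp), zero_mul, zero_add, mul_smul_comm, add_zero]
  have hs := finite_support_smul_polyDP_polyDPt f
  have h1 := mul_finsum (fun l : ℕ+ => (l : ℚ) • polyDP l (polyDPt l f)) (X (Sum.inr k))
  rw [finsum_congr h, finsum_add_distrib, h1]
  · congr 1
    rw [finsum_eq_single _ k fun l hl => if_neg hl, if_pos rfl]
  · refine hs.subset fun l hl => ?_
    rw [Function.mem_support] at hl ⊢
    intro h0
    exact hl (by rw [h0, mul_zero])
  · refine (Set.finite_singleton k).subset fun l hl => ?_
    rw [Function.mem_support] at hl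
    by_contra hne
    exact hl (if_neg hne)

theorem polyMixedSum_rename_inl (f : MvPolynomial ℕ+ ℚ) :
    polyMixedSum (rename Sum.inl f) = 0 := by
  rw [polyMixedSum_apply, mixedSum]
  refine (finsum_congr fun k => ?_).trans finsum_zero
  have : polyDPt k (rename Sum.inl f) = 0 := by
    refine pderiv_eq_zero_of_notMem_vars fun h => ?_
    classical
    obtain ⟨_, _, h⟩ := Finset.mem_image.mp (vars_rename _ _ h)
    simp at h
  rw [this, map_zero, smul_zero]

theorem pderiv_inl_rename_inr (k : ℕ+) (f : MvPolynomial ℕ+ ℚ) :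
    pderiv (Sum.inl k) (rename Sum.inr f : PolyXY) = 0 := by
  refine pderiv_eq_zero_of_notMem_vars fun h => ?_
  classical
  obtain ⟨_, _, h⟩ := Finset.mem_image.mp (vars_rename _ _ h)
  simp at h

/-- Local nilpotency is preserved by multiplication with each variable `p̃_k`, and it holds on the
polynomials in the `p_k`. -/
theorem exists_pow_polyMixedSum_mul_eq_zero (f g : MvPolynomial ℕ+ ℚ) :
    ∃ N, (polyMixedSum ^ N) (rename Sum.inr g * rename Sum.inl f) = 0 := by
  induction g using MvPolynomial.induction_on with
  | C a =>
    refine ⟨1, ?_⟩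
    rw [pow_one, rename_C, ← smul_eq_C_mul, map_smul, polyMixedSum_rename_inl, smul_zero]
  | add p q hp hq =>
    obtain ⟨N, hN⟩ := hp
    obtain ⟨N', hN'⟩ := hq
    refine ⟨max N N', ?_⟩
    rw [map_add, add_mul, map_add, pow_apply_eq_zero_of_le hN (le_max_left _ _),
      pow_apply_eq_zero_of_le hN' (le_max_right _ _), add_zero]
  | mul_X p k hp =>
    obtain ⟨N, hN⟩ := hp
    refine ⟨N + 1, ?_⟩
    rw [map_mul (rename Sum.inr), rename_X, mul_comm (rename _ p), mul_assoc]
    exact pow_succ_apply_eq_zero (polyMixedSum_mul_mulLeft_inr k)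
      (by rw [mul_smul_comm, smul_mul_assoc, polyDP, polyMixedSum_mul_pderiv]) hN

theorem expEnd_polyMixedSum_X_inr_mul (k : ℕ+) (f g : MvPolynomial ℕ+ ℚ) :
    expEnd polyMixedSum (X (Sum.inr k) * (rename Sum.inr g * rename Sum.inl f)) =
      X (Sum.inr k) * expEnd polyMixedSum (rename Sum.inr g * rename Sum.inl f) +
        (k : ℚ) • pderiv (Sum.inl k)
          (expEnd polyMixedSum (rename Sum.inr g * rename Sum.inl f)) := by
  obtain ⟨N, hN⟩ := exists_pow_polyMixedSum_mul_eq_zero f g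
  exact expEnd_apply_of_commutator (polyMixedSum_mul_mulLeft_inr k)
      (by rw [mul_smul_comm, smul_mul_assoc, polyDP, polyMixedSum_mul_pderiv]) hN

theorem expEnd_polyMixedSum_rename_inl (f : MvPolynomial ℕ+ ℚ) :
    expEnd polyMixedSum (rename Sum.inl f) = rename Sum.inl f := by
  rw [expEnd_eq_sum (N := 1) (by rw [pow_one, polyMixedSum_rename_inl])]
  simp

end Polynomial

/-! ### A determinant identity for coefficients of power series -/

section Determinant

open PowerSeries

variable {S : Type*} [CommRing S]

/-- Both sides are sums of the products of a coefficient of `Z` and a coefficient of `Q`; the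
factors `coeff n (X ^ k * Z)` are the coefficients of `Z` at `n - k`, and vanish for `k > n`. -/
theorem coeff_mul_eq_sum_range {Z Q : S⟦X⟧} {n d : ℕ}
    (h : ∀ k, k ≤ n → d ≤ k → coeff k Q = 0) :
    coeff n (Z * Q) = ∑ k ∈ Finset.range d, coeff n (X ^ k * Z) * coeff k Q := by
  rw [mul_comm, coeff_mul, Finset.Nat.sum_antidiagonal_eq_sum_range_succ_mk]
  have h1 : ∀ k ∈ Finset.range (n + 1), coeff k Q * coeff (n - k) Z =
      coeff n (X ^ k * Z) * coeff k Q := by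
    intro k hk
    rw [coeff_X_pow_mul', if_pos (Finset.mem_range_succ_iff.mp hk), mul_comm]
  rw [Nat.succ_eq_add_one, Finset.sum_congr rfl h1]
  rw [← Finset.sum_subset (Finset.inter_subset_left (s₂ := Finset.range d))]
  · refine Finset.sum_subset Finset.inter_subset_right fun k hk hk' => ?_
    rw [Finset.mem_range] at hk
    rw [Finset.mem_inter, Finset.mem_range, Finset.mem_range] at hk'
    rw [coeff_X_pow_mul', if_neg (by omega), zero_mul]
  · intro k hk hk'
    rw [Finset.mem_range] at hk
    rw [Finset.mem_inter, Finset.mem_range, Finset.mem_range] at hk'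
    rw [h k (by omega) (by omega), mul_zero]

theorem coeff_prod_one_sub_eq_zero {ι : Type*} (s : Finset ι) (x : ι → S) (n : ℕ)
    (hn : s.card < n) : coeff n (∏ l ∈ s, (1 - C (x l) * X)) = 0 := by
  classical
  induction s using Finset.induction_on generalizing n with
  | empty => rw [Finset.prod_empty, coeff_one, if_neg (by simp at hn; omega)]
  | insert a s ha ih =>
    rw [Finset.card_insert_of_notMem ha] at hn
    obtain ⟨n, rfl⟩ := Nat.exists_eq_succ_of_ne_zero (by omega : n ≠ 0)
    rw [Finset.prod_insert ha, sub_mul, one_mul, map_sub, ih _ (by omega), mul_assoc, coeff_C_mul,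
      coeff_succ_X_mul, ih _ (by omega), mul_zero, sub_zero]

variable {d : ℕ} (x : Fin d → S)

theorem geomSeries_mul_prod_one_sub (j : Fin d) :
    (∏ l, (1 - C (x l) * X)) * geomSeries (x j) =
      ∏ l ∈ Finset.univ.erase j, (1 - C (x l) * X) := by
  rw [← Finset.mul_prod_erase _ _ (Finset.mem_univ j), mul_right_comm, mul_comm (1 - _),
    geomSeries_mul_one_sub, one_mul]

/-- The matrix of the coefficients of the polynomials `∏_{l ≠ j} (1 - x_l t)` is a unitriangular
matrix times the Vandermonde matrix. -/
theorem det_coeff_prod_mul_geomSeries :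
    (Matrix.of fun k j : Fin d => coeff (k : ℕ) ((∏ l, (1 - C (x l) * X)) * geomSeries (x j))).det =
      (Matrix.of fun i j : Fin d => x j ^ (i : ℕ)).det := by
  have h : (Matrix.of fun k j : Fin d =>
      coeff (k : ℕ) ((∏ l, (1 - C (x l) * X)) * geomSeries (x j))) =
      (Matrix.of fun k r : Fin d => coeff (k : ℕ) (X ^ (r : ℕ) * ∏ l, (1 - C (x l) * X))) *
        Matrix.of fun i j : Fin d => x j ^ (i : ℕ) := by
    ext k j
    rw [Matrix.mul_apply, Matrix.of_apply, coeff_mul_eq_sum_range (d := d) (fun i hi hd => by omega),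
      Finset.sum_range]
    simp only [geomSeries, coeff_mk, Matrix.of_apply]
  rw [h, Matrix.det_mul, Matrix.det_of_isLowerTriangular, Finset.prod_eq_one, one_mul]
  · intro k _
    rw [Matrix.of_apply, coeff_X_pow_mul', if_pos le_rfl, Nat.sub_self,
      coeff_zero_eq_constantCoeff_apply, map_prod]
    refine Finset.prod_eq_one fun l _ => ?_
    simp
  · intro k r hkr
    have hkr : k < r := hkr
    rw [Matrix.of_apply, coeff_X_pow_mul', if_neg (by simpa using hkr)]

/-- Multiplying the series `H` by all the `1 / (1 - x_j t)` and the determinant of its shifted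
coefficients by the Vandermonde determinant amounts to multiplying `H` by the single factor
`1 / (1 - x_j t)` in column `j`. -/
theorem det_coeff_mul_det_vandermonde (H : S⟦X⟧) (a : Fin d → ℕ) :
    (Matrix.of fun i j : Fin d => x j ^ (i : ℕ)).det *
      (Matrix.of fun i k : Fin d =>
        coeff (a i) (X ^ (k : ℕ) * (H * ∏ j, geomSeries (x j)))).det =
      (Matrix.of fun i j : Fin d => coeff (a i) (H * geomSeries (x j))).det := by
  rw [← det_coeff_prod_mul_geomSeries, mul_comm, ← Matrix.det_mul]
  congr 1
  ext i j
  have h1 : H * geomSeries (x j) = (H * ∏ j, geomSeries (x j)) *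
      ((∏ l, (1 - C (x l) * X)) * geomSeries (x j)) := by
    have : (∏ j, geomSeries (x j)) * ∏ l, (1 - C (x l) * X) = 1 := by
      rw [← Finset.prod_mul_distrib]
      exact Finset.prod_eq_one fun l _ => geomSeries_mul_one_sub (x l)
    linear_combination -H * geomSeries (x j) * this
  rw [Matrix.mul_apply, Matrix.of_apply, h1, coeff_mul_eq_sum_range (d := d), Finset.sum_range]
  · simp only [Matrix.of_apply]
  · intro k _ hk
    rw [geomSeries_mul_prod_one_sub]
    refine coeff_prod_one_sub_eq_zero _ _ _ ?_
    rw [Finset.card_erase_of_mem (Finset.mem_univ j), Finset.card_univ, Fintype.card_fin]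
    have := j.2
    omega

end Determinant

/-! ### The exponential on products of complete homogeneous symmetric functions -/

section Generating

open MvPolynomial

/-- The symmetric function `h_{n - r}` (zero if `n < r`), as a polynomial in the power sums. -/
def hShift (n r : ℕ) : MvPolynomial ℕ+ ℚ := PowerSeries.coeff n (PowerSeries.X ^ r * hsumGen)

theorem hShift_of_lt {n r : ℕ} (h : n < r) : hShift n r = 0 := by
  rw [hShift, PowerSeries.coeff_X_pow_mul', if_neg (by omega)]

theorem hShift_self (n : ℕ) : hShift n n = 1 := by
  rw [hShift, PowerSeries.coeff_X_pow_mul', if_pos le_rfl, Nat.sub_self,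
    PowerSeries.coeff_zero_eq_constantCoeff_apply, isNewtonPair_gen.1]

theorem hShift_succ_succ (n r : ℕ) : hShift (n + 1) (r + 1) = hShift n r := by
  rw [hShift, hShift, PowerSeries.coeff_X_pow_mul', PowerSeries.coeff_X_pow_mul']
  simp

theorem smul_pderiv_hShift (k : ℕ+) (n r : ℕ) :
    ((k : ℚ) • pderiv (R := ℚ) k) (hShift n r) = hShift n (k + r) := by
  have h := isNewtonPair_gen.derivation_coeff ((k : ℚ) • pderiv k) k k.ne_zero (fun j => by
    rw [psumGen, PowerSeries.coeff_mk, Derivation.smul_apply]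
    split_ifs with h1 h2 h2
    · have : j.toPNat h1 = k := PNat.eq h2
      rw [this, pderiv_X_self, smul_eq_C_mul, mul_one, map_natCast]
    · rw [pderiv_X_of_ne, smul_zero]
      intro h3
      exact h2 (congrArg PNat.val h3)
    · exact absurd (h2 ▸ k.pos) h1
    · rw [map_zero, smul_zero])
  rw [hShift, hShift, PowerSeries.coeff_X_pow_mul']
  split_ifs with hr
  · rw [h, add_comm, pow_add, mul_assoc, PowerSeries.coeff_X_pow_mul' _ r n, if_pos hr]
  · rw [map_zero, PowerSeries.coeff_X_pow_mul', if_neg (by omega)]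

theorem derivation_prod {R : Type*} [CommRing R] [Algebra ℚ R] (D : Derivation ℚ R R)
    {ι : Type*} [DecidableEq ι] (s : Finset ι) (f : ι → R) :
    D (∏ i ∈ s, f i) = ∑ j ∈ s, ∏ i ∈ s, if i = j then D (f i) else f i := by
  induction s using Finset.induction_on with
  | empty => simp
  | insert a s ha ih =>
    rw [Finset.prod_insert ha, D.leibniz, ih, Finset.sum_insert ha, Finset.prod_insert ha,
      if_pos rfl, smul_eq_mul, smul_eq_mul, Finset.mul_sum, add_comm]
    congr 1
    · rw [mul_comm]
      congr 1
      refine Finset.prod_congr rfl fun i hi => (if_neg ?_).symm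
      rintro rfl
      exact ha hi
    · refine Finset.sum_congr rfl fun j hj => ?_
      rw [Finset.prod_insert ha, if_neg]
      rintro rfl
      exact ha hj

variable {d : ℕ}

/-- The product `∏_j h_{b_j - r_j}`, as a polynomial in the power sums. -/
def hProd (b : Fin d → ℕ) (r : Fin d →₀ ℕ) : MvPolynomial ℕ+ ℚ := ∏ j, hShift (b j) (r j)

theorem smul_pderiv_hProd (k : ℕ+) (b : Fin d → ℕ) (r : Fin d →₀ ℕ) :
    ((k : ℚ) • pderiv (R := ℚ) k) (hProd b r) =
      ∑ j, hProd b (Finsupp.single j (k : ℕ) + r) := by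
  rw [hProd, derivation_prod]
  refine Finset.sum_congr rfl fun j _ => Finset.prod_congr rfl fun i _ => ?_
  rw [smul_pderiv_hShift, Finsupp.add_apply, Finsupp.single_apply]
  split_ifs with h1 h2 h2
  · rfl
  · exact absurd h1.symm h2
  · exact absurd h2.symm h1
  · rw [zero_add]

/-- The linear map that sends the monomial `x ^ r` with coefficient `c` to
`c(p̃) ∏_j h_{b_j - r_j}(p)`. It is the coefficient of `x ^ b` in the product of the argument with
the generating series `∏_j ∑_n h_n x_j ^ n`. -/
def coeffH (b : Fin d → ℕ) :
    MvPolynomial (Fin d) (MvPolynomial ℕ+ ℚ) →+ PolyXY :=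
  ((basisMonomials (Fin d) PolyXY).constr ℚ fun r =>
    rename Sum.inl (hProd b r)).toAddMonoidHom.comp
      (MvPolynomial.map (rename (R := ℚ) (Sum.inr : ℕ+ → ℕ+ ⊕ ℕ+)).toRingHom).toAddMonoidHom

theorem coeffH_monomial (b : Fin d → ℕ) (r : Fin d →₀ ℕ) (c : MvPolynomial ℕ+ ℚ) :
    coeffH b (monomial r c) = rename Sum.inr c * rename Sum.inl (hProd b r) := by
  change (basisMonomials (Fin d) PolyXY).constr ℚ (fun r => rename Sum.inl (hProd b r))
    (MvPolynomial.map _ (monomial r c)) = _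
  rw [map_monomial]
  have : monomial r ((rename (R := ℚ) (Sum.inr : ℕ+ → ℕ+ ⊕ ℕ+)).toRingHom c) =
      (rename Sum.inr c : PolyXY) • basisMonomials (Fin d) PolyXY r := by
    rw [coe_basisMonomials, smul_monomial, smul_eq_mul, mul_one]
    rfl
  rw [this, map_smul, Module.Basis.constr_basis, smul_eq_mul]

theorem coeffH_C_mul (b : Fin d → ℕ) (c : MvPolynomial ℕ+ ℚ)
    (q : MvPolynomial (Fin d) (MvPolynomial ℕ+ ℚ)) :
    coeffH b (C c * q) = rename Sum.inr c * coeffH b q := by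
  induction q using MvPolynomial.induction_on' with
  | monomial r e => rw [C_mul_monomial, coeffH_monomial, coeffH_monomial, map_mul, mul_assoc]
  | add p q hp hq => rw [mul_add, map_add, map_add, mul_add, hp, hq]

/-- The generating series `∏_j ∑_n h_n x_j ^ n` is an eigenvector of `k ∂/∂p_k`, and the coefficients
of `q` do not involve the `p_k`. -/
theorem smul_pderiv_coeffH (b : Fin d → ℕ) (k : ℕ+)
    (q : MvPolynomial (Fin d) (MvPolynomial ℕ+ ℚ)) :
    (k : ℚ) • pderiv (Sum.inl k) (coeffH b q) = coeffH b ((∑ j, X j ^ (k : ℕ)) * q) := by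
  induction q using MvPolynomial.induction_on' with
  | monomial r e =>
    rw [coeffH_monomial, pderiv_mul, pderiv_inl_rename_inr, zero_mul, zero_add,
      pderiv_rename Sum.inl_injective, ← mul_smul_comm, ← map_smul, ← Derivation.smul_apply,
      smul_pderiv_hProd, map_sum, Finset.mul_sum, Finset.sum_mul, map_sum]
    refine Finset.sum_congr rfl fun j _ => ?_
    rw [X_pow_eq_monomial, monomial_mul, one_mul, coeffH_monomial]
  | add p q hp hq => rw [mul_add, map_add, map_add, map_add, smul_add, hp, hq]

/-- The coefficient of `x ^ b` in a product of series, each in its own variable `x_j`, is the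
product of their coefficients of `x_j ^ b_j`. -/
theorem coeffH_prod_sum (b : Fin d → ℕ) (N : ℕ) (c : Fin d → ℕ → MvPolynomial ℕ+ ℚ) :
    coeffH b (∏ j, ∑ k ∈ Finset.range N, C (c j k) * X j ^ k) =
      ∏ j, ∑ k ∈ Finset.range N, rename Sum.inr (c j k) * rename Sum.inl (hShift (b j) k) := by
  rw [Finset.prod_univ_sum, Finset.prod_univ_sum, map_sum]
  refine Finset.sum_congr rfl fun κ _ => ?_
  have h : ∏ j, C (c j (κ j)) * X j ^ κ j =
      monomial (Finsupp.equivFunOnFinite.symm κ) (∏ j, c j (κ j)) := by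
    rw [Finset.prod_mul_distrib, ← map_prod, monomial_eq, Finsupp.prod_fintype]
    · rfl
    · intro i
      exact pow_zero _
  rw [h, coeffH_monomial, Finset.prod_mul_distrib, map_prod, hProd, map_prod]
  rfl

/-- The addition of new variables `x_j` to the alphabet: the algebra homomorphism with
`p_k ↦ p_k + ∑_j x_j ^ k`. -/
def addVars (d : ℕ) : MvPolynomial ℕ+ ℚ →ₐ[ℚ] MvPolynomial (Fin d) (MvPolynomial ℕ+ ℚ) :=
  aeval fun k => C (X k) + ∑ j, X j ^ (k : ℕ)

/-- Adding the variables `x_j` to the alphabet adds `∑_j x_j ^ k` to the power sums, and so, by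
uniqueness in Newton's identity, multiplies the generating series of the `h_n` by the geometric
series of the `x_j`. -/
theorem map_addVars_hsumGen (d : ℕ) : PowerSeries.map (addVars d).toRingHom hsumGen =
    PowerSeries.map (C (σ := Fin d)) hsumGen * ∏ j : Fin d, geomSeries (X j) := by
  refine (isNewtonPair_gen.map _).unique ?_
  have h := (isNewtonPair_gen.map (C (σ := Fin d))).mul
    (IsNewtonPair.prod Finset.univ fun (j : Fin d) _ =>
      isNewtonPair_geomSeries (X j : MvPolynomial (Fin d) (MvPolynomial ℕ+ ℚ)))
  convert h using 1
  ext1 n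
  rw [PowerSeries.coeff_map, map_add, PowerSeries.coeff_map, map_sum, psumGen, PowerSeries.coeff_mk]
  simp only [PowerSeries.coeff_mk]
  split_ifs with h1 h2 h2
  · omega
  · change aeval _ (X _) = _
    rw [aeval_X]
    rfl
  · simp
  · omega

theorem addVars_hShift (n r : ℕ) : addVars d (hShift n r) = PowerSeries.coeff n
    (PowerSeries.X ^ r *
      (PowerSeries.map (C (σ := Fin d)) hsumGen * ∏ j : Fin d, geomSeries (X j))) := by
  rw [← map_addVars_hsumGen, ← PowerSeries.map_X (addVars d).toRingHom, ← map_pow, ← map_mul,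
    PowerSeries.coeff_map]
  rfl

/-- The induction absorbs each variable of `f` into one of the polynomials `f₁`, `f₂`. -/
theorem exists_pow_polyMixedSum_eq_zero (f : PolyXY) : ∃ N, (polyMixedSum ^ N) f = 0 := by
  suffices h : ∀ f₁ f₂ : MvPolynomial ℕ+ ℚ, ∃ N,
      (polyMixedSum ^ N) (f * (rename Sum.inr f₂ * rename Sum.inl f₁)) = 0 by
    simpa using h 1 1
  induction f using MvPolynomial.induction_on with
  | C a =>
    intro f₁ f₂
    obtain ⟨N, hN⟩ := exists_pow_polyMixedSum_mul_eq_zero f₁ f₂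
    exact ⟨N, by rw [← smul_eq_C_mul, map_smul, hN, smul_zero]⟩
  | add p q hp hq =>
    intro f₁ f₂
    obtain ⟨N, hN⟩ := hp f₁ f₂
    obtain ⟨N', hN'⟩ := hq f₁ f₂
    refine ⟨max N N', ?_⟩
    rw [add_mul, map_add, pow_apply_eq_zero_of_le hN (le_max_left _ _),
      pow_apply_eq_zero_of_le hN' (le_max_right _ _), add_zero]
  | mul_X p s hp =>
    intro f₁ f₂
    rcases s with k | k
    · obtain ⟨N, hN⟩ := hp (X k * f₁) f₂
      refine ⟨N, ?_⟩
      rw [map_mul (rename Sum.inl), rename_X] at hN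
      rwa [mul_assoc, mul_left_comm (X _)]
    · obtain ⟨N, hN⟩ := hp f₁ (X k * f₂)
      refine ⟨N, ?_⟩
      rw [map_mul (rename Sum.inr), rename_X] at hN
      rwa [mul_assoc, ← mul_assoc (X _)]

/-- The operator `exp (∑ k ∂_k ∂̃_k)` on polynomials, as a linear map. -/
def polyExp : PolyXY →ₗ[ℚ] PolyXY where
  toFun := expEnd polyMixedSum
  map_add' f g := by
    obtain ⟨N, hN⟩ := exists_pow_polyMixedSum_eq_zero f
    obtain ⟨N', hN'⟩ := exists_pow_polyMixedSum_eq_zero g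
    have h1 := pow_apply_eq_zero_of_le hN (le_max_left N N')
    have h2 := pow_apply_eq_zero_of_le hN' (le_max_right N N')
    rw [expEnd_eq_sum h1, expEnd_eq_sum h2,
      expEnd_eq_sum (N := max N N') (by rw [map_add, h1, h2, add_zero]), ← Finset.sum_add_distrib]
    simp only [map_add, smul_add]
  map_smul' c f := by
    obtain ⟨N, hN⟩ := exists_pow_polyMixedSum_eq_zero f
    rw [expEnd_eq_sum hN, expEnd_eq_sum (N := N) (by rw [map_smul, hN, smul_zero]),
      Finset.smul_sum]
    simp only [map_smul, RingHom.id_apply, smul_comm c]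

theorem polyExp_apply (f : PolyXY) : polyExp f = expEnd polyMixedSum f := rfl

/-- The generating series form of the statement: `exp (∑ k ∂_k ∂̃_k)` sends
`g(p̃) ∏_j ∑_n h_n(p) x_j ^ n` to the product of the same generating series with `g` after the
variables `x_j` were added to its alphabet. Induction on `g`: multiplication by `p̃_k` is turned
into multiplication by `p̃_k + k ∂_k`, and the generating series is an eigenvector of `k ∂_k` with
the eigenvalue `∑_j x_j ^ k`. -/
theorem polyExp_mul_hProd (b : Fin d → ℕ) (r : Fin d →₀ ℕ) (g : MvPolynomial ℕ+ ℚ) :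
    polyExp (rename Sum.inr g * rename Sum.inl (hProd b r)) =
      coeffH b (monomial r 1 * addVars d g) := by
  induction g using MvPolynomial.induction_on with
  | C a =>
    rw [rename_C, ← smul_eq_C_mul, map_smul, polyExp_apply, expEnd_polyMixedSum_rename_inl,
      ← algebraMap_eq, AlgHom.commutes, mul_comm, IsScalarTower.algebraMap_apply ℚ
        (MvPolynomial ℕ+ ℚ), algebraMap_eq, coeffH_C_mul, coeffH_monomial, map_one, one_mul,
      algebraMap_eq, rename_C, smul_eq_C_mul]
  | add p q hp hq => rw [map_add, add_mul, map_add, map_add, mul_add, map_add, hp, hq]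
  | mul_X p k hp =>
    rw [map_mul (rename Sum.inr), rename_X, mul_comm (rename _ p), mul_assoc, polyExp_apply,
      expEnd_polyMixedSum_X_inr_mul, ← polyExp_apply, hp, smul_pderiv_coeffH, map_mul (addVars d),
      addVars, aeval_X, ← addVars, mul_comm (addVars d p), mul_left_comm, add_mul, mul_add,
      map_add, mul_left_comm _ (C _), coeffH_C_mul, rename_X]

/-- The Jacobi–Trudi determinant `det (h_{b_j - i})`, as a polynomial in the power sums. -/
def schurDet (b : Fin d → ℕ) : MvPolynomial ℕ+ ℚ :=
  (Matrix.of fun i j : Fin d => hShift (b j) i).det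

/-- The form of the theorem in the power sums. Here `N` only bounds the inner sum, whose terms
vanish for `k > a_i`. -/
theorem polyExp_schurDet (a b : Fin d → ℕ) (N : ℕ) (hN : ∀ i, a i < N) :
    polyExp (rename Sum.inr (schurDet a) * rename Sum.inl (schurDet b)) =
      (Matrix.of fun i j : Fin d => ∑ k ∈ Finset.range N,
        (rename Sum.inr (hShift (a i) k) * rename Sum.inl (hShift (b j) k) : PolyXY)).det := by
  have h1 : ∀ g : MvPolynomial ℕ+ ℚ, polyExp (rename Sum.inr g * rename Sum.inl (schurDet b)) =
      coeffH b ((Matrix.of fun i j : Fin d => X j ^ (i : ℕ)).det * addVars d g) := by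
    intro g
    rw [schurDet, Matrix.det_apply, Matrix.det_apply, map_sum, Finset.mul_sum, Finset.sum_mul,
      map_sum, map_sum]
    refine Finset.sum_congr rfl fun σ _ => ?_
    have h := polyExp_mul_hProd b (Finsupp.equivFunOnFinite.symm fun j => (σ j : ℕ)) g
    -- Row indices of `det (h_{b_j - i})` are shifts, that is, exponents of the monomials `x ^ σ`.
    have h2 : monomial (Finsupp.equivFunOnFinite.symm fun j => (σ j : ℕ))
        (1 : MvPolynomial ℕ+ ℚ) = ∏ j : Fin d, X j ^ (σ j : ℕ) := by
      rw [monomial_eq, Finsupp.prod_fintype _ _ fun i => pow_zero _, map_one, one_mul]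
      rfl
    rw [h2] at h
    simp only [Matrix.of_apply]
    rw [Units.smul_def, Units.smul_def, map_zsmul, mul_smul_comm, smul_mul_assoc, map_zsmul,
      map_zsmul, ← h]
    rfl
  rw [h1]
  have h2 : addVars d (schurDet a) = (Matrix.of fun i k : Fin d => PowerSeries.coeff (a i)
      (PowerSeries.X ^ (k : ℕ) * (PowerSeries.map (C (σ := Fin d)) hsumGen *
        ∏ j : Fin d, geomSeries (X j)))).det := by
    rw [schurDet, ← Matrix.det_transpose, AlgHom.map_det]
    congr 1
    ext1 i k
    exact addVars_hShift (a i) k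
  rw [h2, det_coeff_mul_det_vandermonde]
  have h3 : ∀ i j : Fin d, PowerSeries.coeff (a i)
      (PowerSeries.map (C (σ := Fin d)) hsumGen * geomSeries (X j)) =
      ∑ k ∈ Finset.range N, C (hShift (a i) k) * X j ^ k := by
    intro i j
    rw [coeff_mul_eq_sum_range (d := N) fun k hk hd => by have := hN i; omega]
    refine Finset.sum_congr rfl fun k _ => ?_
    rw [geomSeries, PowerSeries.coeff_mk, hShift, ← PowerSeries.map_X (C (σ := Fin d)), ← map_pow,
      ← map_mul, PowerSeries.coeff_map]
  simp only [h3]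
  rw [Matrix.det_apply, Matrix.det_apply, map_sum]
  refine Finset.sum_congr rfl fun σ _ => ?_
  rw [Units.smul_def, Units.smul_def, map_zsmul]
  simp only [Matrix.of_apply]
  rw [coeffH_prod_sum]

end Generating

/-! ### Transport of the operator along injective maps -/

section Transport

variable {M M' : Type*} [AddCommGroup M] [Module ℚ M] [AddCommGroup M'] [Module ℚ M']
  {D D' : ℕ+ → Module.End ℚ M} {E E' : ℕ+ → Module.End ℚ M'} {φ : M → M'}

/-- An injective linear map that intertwines the operators `D_k`, `D'_k` with `E_k`, `E'_k`. -/
structure Intertwines (D D' : ℕ+ → Module.End ℚ M) (E E' : ℕ+ → Module.End ℚ M')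
    (φ : M → M') : Prop where
  injective : Function.Injective φ
  map_add : ∀ f g, φ (f + g) = φ f + φ g
  map_smul : ∀ (c : ℚ) f, φ (c • f) = c • φ f
  map_left : ∀ k f, φ (D k f) = E k (φ f)
  map_right : ∀ k f, φ (D' k f) = E' k (φ f)

namespace Intertwines

theorem map_zero (h : Intertwines D D' E E' φ) : φ 0 = 0 := by
  have := h.map_smul 0 0
  rwa [zero_smul, zero_smul] at this

theorem map_finsum (h : Intertwines D D' E E' φ) {ι : Type*} (u : ι → M) :
    φ (∑ᶠ i, u i) = ∑ᶠ i, φ (u i) :=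
  AddMonoidHom.map_finsum_of_injective ⟨⟨φ, h.map_zero⟩, h.map_add⟩ h.injective u

theorem iterate_mixedSum (h : Intertwines D D' E E' φ) (n : ℕ) (f : M) :
    (mixedSum E E')^[n] (φ f) = φ ((mixedSum D D')^[n] f) := by
  have hs : Function.Semiconj φ (mixedSum D D') (mixedSum E E') := by
    intro f
    rw [mixedSum, mixedSum, h.map_finsum]
    simp only [h.map_smul, h.map_left, h.map_right]
  exact ((hs.iterate_right n) f).symm

theorem expMixedSumFinite (h : Intertwines D D' E E' φ) {f : M}
    (hf : ExpMixedSumFinite D D' f) : ExpMixedSumFinite E E' (φ f) := by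
  refine ⟨fun n => (hf.1 n).subset fun k hk h0 => hk ?_, hf.2.subset fun n hn h0 => hn ?_⟩
  · rw [h.iterate_mixedSum, ← h.map_right, ← h.map_left, h0, h.map_zero]
  · rw [h.iterate_mixedSum, h0, h.map_zero]

theorem expMixedSum (h : Intertwines D D' E E' φ) (f : M) :
    expMixedSum E E' (φ f) = φ (expMixedSum D D' f) := by
  rw [TracyWidom.expMixedSum, TracyWidom.expMixedSum, h.map_finsum]
  simp only [h.map_smul, h.iterate_mixedSum]

end Intertwines

theorem expMixedSumFinite_poly (f : PolyXY) : ExpMixedSumFinite polyDP polyDPt f := by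
  refine ⟨fun n => finite_polyDP_polyDPt _, ?_⟩
  obtain ⟨N, hN⟩ := exists_pow_polyMixedSum_eq_zero f
  refine (Set.finite_lt_nat N).subset fun n hn => ?_
  by_contra h
  refine hn ?_
  rw [← pow_polyMixedSum_apply]
  exact pow_apply_eq_zero_of_le hN (not_lt.mp h)

theorem expMixedSum_poly (f : PolyXY) : expMixedSum polyDP polyDPt f = polyExp f := by
  rw [polyExp_apply, expMixedSum, expEnd]
  simp only [pow_polyMixedSum_apply]

theorem fatPderiv_psumEquivXY (s : ℕ+ ⊕ ℕ+) (f : PolyXY) :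
    fatPderiv s (psumEquivXY f) = psumEquivXY (MvPolynomial.pderiv s f) := by
  change psumEquivXY (MvPolynomial.pderiv s (psumEquivXY.symm (psumEquivXY f))) = _
  rw [AlgEquiv.symm_apply_apply]

theorem intertwines_psumEquivXY : Intertwines polyDP polyDPt fatDP fatDPt psumEquivXY where
  injective := psumEquivXY.injective
  map_add f g := psumEquivXY.toLinearMap.map_add f g
  map_smul c f := psumEquivXY.toLinearMap.map_smul c f
  map_left k f := (fatPderiv_psumEquivXY (Sum.inl k) f).symm
  map_right k f := (fatPderiv_psumEquivXY (Sum.inr k) f).symm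

theorem fatDelta_psumEquivXY (f : PolyXY) :
    ExpMixedSumFinite fatDP fatDPt (psumEquivXY f) ∧
      fatDelta (psumEquivXY f) = psumEquivXY (polyExp f) := by
  rw [← expMixedSum_poly]
  exact ⟨intertwines_psumEquivXY.expMixedSumFinite (expMixedSumFinite_poly f),
    intertwines_psumEquivXY.expMixedSum f⟩

theorem intertwines_coe : Intertwines polyDP polyDPt dP dPt (fun f : PolyXY => (f : V)) where
  injective := MvPolynomial.coe_injective (ℕ+ ⊕ ℕ+) ℚ
  map_add := MvPolynomial.coe_add
  map_smul c f := MvPolynomial.coe_smul f c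
  map_left _ f := (MvPowerSeries.pderiv_coe f).symm
  map_right _ f := (MvPowerSeries.pderiv_coe f).symm

theorem Delta_coe (f : PolyXY) :
    ExpMixedSumFinite dP dPt (f : V) ∧ Delta (f : V) = ((polyExp f : PolyXY) : V) := by
  rw [← expMixedSum_poly]
  exact ⟨intertwines_coe.expMixedSumFinite (expMixedSumFinite_poly f),
    intertwines_coe.expMixedSum f⟩

theorem specialize_psumEquivXY (f : PolyXY) : specialize (psumEquivXY f) = (f : V) := by
  simp [specialize]

end Transport

/-! ### The Tracy–Widom determinants as polynomials in the power sums -/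

section Determinants

open MvPolynomial

theorem psumEquivXY_rename_inl (f : MvPolynomial ℕ+ ℚ) :
    psumEquivXY (rename Sum.inl f) = psumEquiv f ⊗ₜ[ℚ] (1 : SymFun) := by
  have h : psumEquivXY.toAlgHom.comp (rename Sum.inl) =
      (Algebra.TensorProduct.includeLeft (R := ℚ) (S := ℚ) (A := SymFun) (B := SymFun)).comp
        psumEquiv.toAlgHom := by
    refine MvPolynomial.algHom_ext fun k => ?_
    change psumEquivXY (rename Sum.inl (X k)) = psumEquiv (X k) ⊗ₜ[ℚ] (1 : SymFun)
    rw [rename_X, psumEquivXY_inl, psumEquiv_X]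
  exact DFunLike.congr_fun h f

theorem psumEquivXY_rename_inr (f : MvPolynomial ℕ+ ℚ) :
    psumEquivXY (rename Sum.inr f) = (1 : SymFun) ⊗ₜ[ℚ] psumEquiv f := by
  have h : psumEquivXY.toAlgHom.comp (rename Sum.inr) =
      (Algebra.TensorProduct.includeRight (R := ℚ) (A := SymFun) (B := SymFun)).comp
        psumEquiv.toAlgHom := by
    refine MvPolynomial.algHom_ext fun k => ?_
    change psumEquivXY (rename Sum.inr (X k)) = (1 : SymFun) ⊗ₜ[ℚ] psumEquiv (X k)
    rw [rename_X, psumEquivXY_inr, psumEquiv_X]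
  exact DFunLike.congr_fun h f

theorem psumEquivXY_det {d : ℕ} (A : Matrix (Fin d) (Fin d) PolyXY) :
    psumEquivXY A.det = (Matrix.of fun i j => psumEquivXY (A i j)).det :=
  RingHom.map_det (R := PolyXY) (S := SymFunXY) psumEquivXY.toRingEquiv.toRingHom A

theorem hInt_sub (n r : ℕ) : hInt ((n : ℤ) - r) = psumEquiv (hShift n r) := by
  rw [hInt, hShift, PowerSeries.coeff_X_pow_mul']
  split_ifs with h1 h2 h2
  · rw [hsumGen, PowerSeries.coeff_mk, AlgEquiv.apply_symm_apply]
    congr 1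
    omega
  · omega
  · omega
  · rw [map_zero]

/-- The strictly increasing sequence `b_j = j + λ_{d - j}`, `0 ≤ j < d`, that encodes a partition
`λ` of length at most `d`. -/
def shiftedPart (d : ℕ) (lam : YoungDiagram) (j : Fin d) : ℕ := j + lam.rowLen j.rev

theorem shiftedPart_bot (d : ℕ) (j : Fin d) : shiftedPart d ⊥ j = j := by
  have : (⊥ : YoungDiagram).rowLen j.rev = 0 := by
    by_contra h
    exact YoungDiagram.notMem_bot _ (YoungDiagram.mem_iff_lt_rowLen.mpr (Nat.pos_of_ne_zero h))
  rw [shiftedPart, this, add_zero]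

/-- The entries of the matrix product as sums over any range that contains the support. -/
theorem fatTW_eq (d : ℕ) (lam μ : YoungDiagram) (N : ℕ)
    (hN : ∀ i j, shiftedPart d μ i < N ∨ shiftedPart d lam j < N) :
    fatTW d lam μ = psumEquivXY (Matrix.of fun i j : Fin d => ∑ k ∈ Finset.range N,
      (rename Sum.inr (hShift (shiftedPart d μ i) k) *
        rename Sum.inl (hShift (shiftedPart d lam j) k) : PolyXY)).det := by
  rw [fatTW, psumEquivXY_det]
  congr 1
  ext1 i j
  rw [Matrix.of_apply]
  have h : ∀ k : ℕ, twLeft d μ i k * twRight d lam k j =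
      psumEquivXY (rename Sum.inr (hShift (shiftedPart d μ i) k) *
        rename Sum.inl (hShift (shiftedPart d lam j) k)) := by
    intro k
    have hshift : ∀ x y : ℕ, (x : ℤ) - k + y = ((x + y : ℕ) : ℤ) - k := fun x y => by
      push_cast
      ring
    rw [map_mul, psumEquivXY_rename_inl, psumEquivXY_rename_inr, ← hInt_sub, ← hInt_sub, twLeft,
      twRight, Matrix.of_apply, Matrix.of_apply, shiftedPart, shiftedPart, hshift, hshift]
  rw [finsum_congr h]
  refine (finsum_eq_sum_of_support_subset _ (s := Finset.range N) fun k hk => ?_).trans ?_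
  · rw [Finset.coe_range, Set.mem_Iio]
    by_contra hkN
    refine hk ?_
    rcases hN i j with h | h
    · simp only [hShift_of_lt (by omega : shiftedPart d μ i < k), map_zero, zero_mul]
    · simp only [hShift_of_lt (by omega : shiftedPart d lam j < k), map_zero, mul_zero]
  · exact (map_sum psumEquivXY _ _).symm

theorem det_hShift_id (d : ℕ) :
    (Matrix.of fun i k : Fin d => (rename Sum.inl (hShift i k) : PolyXY)).det = 1 ∧
    (Matrix.of fun i k : Fin d => (rename Sum.inr (hShift i k) : PolyXY)).det = 1 := by
  constructor <;>
  · rw [Matrix.det_of_isLowerTriangular, Finset.prod_eq_one]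
    · intro k _
      rw [Matrix.of_apply, hShift_self, map_one]
    · intro i k hik
      have hik : i < k := hik
      rw [Matrix.of_apply, hShift_of_lt hik, map_zero]

theorem fatTW_bot_right (d : ℕ) (lam : YoungDiagram) :
    fatTW d lam ⊥ = psumEquivXY (rename Sum.inl (schurDet (shiftedPart d lam))) := by
  rw [fatTW_eq d lam ⊥ d fun i j => Or.inl (by rw [shiftedPart_bot]; exact i.2)]
  congr 1
  have h : (Matrix.of fun i j : Fin d => ∑ k ∈ Finset.range d,
      (rename Sum.inr (hShift (shiftedPart d ⊥ i) k) *
        rename Sum.inl (hShift (shiftedPart d lam j) k) : PolyXY)) =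
      (Matrix.of fun i k : Fin d => (rename Sum.inr (hShift i k) : PolyXY)) *
        Matrix.of fun i j : Fin d => (rename Sum.inl (hShift (shiftedPart d lam j) i) : PolyXY) := by
    ext1 i j
    rw [Matrix.mul_apply, Matrix.of_apply, Finset.sum_range, shiftedPart_bot]
    rfl
  rw [h, Matrix.det_mul, (det_hShift_id d).2, one_mul, schurDet, AlgHom.map_det]
  rfl

theorem fatTW_bot_left (d : ℕ) (μ : YoungDiagram) :
    fatTW d ⊥ μ = psumEquivXY (rename Sum.inr (schurDet (shiftedPart d μ))) := by
  rw [fatTW_eq d ⊥ μ d fun i j => Or.inr (by rw [shiftedPart_bot]; exact j.2)]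
  congr 1
  have h : (Matrix.of fun i j : Fin d => ∑ k ∈ Finset.range d,
      (rename Sum.inr (hShift (shiftedPart d μ i) k) *
        rename Sum.inl (hShift (shiftedPart d ⊥ j) k) : PolyXY)) =
      (Matrix.of fun i j : Fin d =>
        (rename Sum.inr (hShift (shiftedPart d μ j) i) : PolyXY)).transpose *
      (Matrix.of fun i k : Fin d => (rename Sum.inl (hShift i k) : PolyXY)).transpose := by
    ext1 i j
    rw [Matrix.mul_apply, Matrix.of_apply, Finset.sum_range, shiftedPart_bot]
    rfl
  rw [h, Matrix.det_mul, Matrix.det_transpose, Matrix.det_transpose, (det_hShift_id d).1, mul_one,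
    schurDet, AlgHom.map_det]
  rfl

/-- If `λ` has length at most `d`, the Jacobi–Trudi determinant of size `d + 1` has the first
column `(1, 0, …, 0)`, and the complementary minor is the determinant of size `d`. -/
theorem schurDet_shiftedPart_succ (d : ℕ) (lam : YoungDiagram) (h : lam.rowLen d = 0) :
    schurDet (shiftedPart (d + 1) lam) = schurDet (shiftedPart d lam) := by
  have h0 : shiftedPart (d + 1) lam 0 = 0 := by
    rw [shiftedPart, Fin.rev_zero, Fin.val_last, h]
    rfl
  have hs : ∀ j : Fin d, shiftedPart (d + 1) lam j.succ = shiftedPart d lam j + 1 := by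
    intro j
    rw [shiftedPart, shiftedPart, Fin.val_succ, Fin.val_rev, Fin.val_rev, Fin.val_succ,
      Nat.add_sub_add_right]
    omega
  rw [schurDet, Matrix.det_succ_column_zero, Fin.sum_univ_succ, Finset.sum_eq_zero]
  · rw [Matrix.of_apply, h0, Fin.val_zero, hShift_self, pow_zero, one_mul, one_mul, add_zero,
      schurDet]
    congr 1
    ext1 i j
    rw [Matrix.submatrix_apply, Matrix.of_apply, Matrix.of_apply, hs, Fin.succAbove_zero,
      Fin.val_succ, hShift_succ_succ]
  · intro i _
    rw [Matrix.of_apply, h0, hShift_of_lt (by simp), mul_zero, zero_mul]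

theorem schurDet_shiftedPart (d : ℕ) (lam : YoungDiagram) (h : lam.colLen 0 ≤ d) :
    schurDet (shiftedPart d lam) = schurDet (shiftedPart (lam.colLen 0) lam) := by
  induction d, h using Nat.le_induction with
  | base => rfl
  | succ d hd ih =>
    rw [schurDet_shiftedPart_succ, ih]
    by_contra h
    have := YoungDiagram.mem_iff_lt_colLen.mp
      (YoungDiagram.mem_iff_lt_rowLen.mpr (Nat.pos_of_ne_zero h))
    omega

theorem polyExp_schurDet_eq_fatTW (lam μ : YoungDiagram) (d d₁ d₂ : ℕ)
    (h₁ : lam.colLen 0 ≤ d₁) (h₂ : μ.colLen 0 ≤ d₂)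
    (h : lam.colLen 0 ≤ d) (h' : μ.colLen 0 ≤ d) :
    psumEquivXY (polyExp (rename Sum.inl (schurDet (shiftedPart d₁ lam)) *
      rename Sum.inr (schurDet (shiftedPart d₂ μ)))) = fatTW d lam μ := by
  have hN : ∀ i, shiftedPart d μ i < Finset.univ.sup (shiftedPart d μ) + 1 := fun i =>
    Nat.lt_succ_of_le (Finset.le_sup (Finset.mem_univ i))
  rw [schurDet_shiftedPart d₁ lam h₁, ← schurDet_shiftedPart d lam h,
    schurDet_shiftedPart d₂ μ h₂, ← schurDet_shiftedPart d μ h', mul_comm,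
    polyExp_schurDet _ _ _ hN, fatTW_eq d lam μ _ fun i j => Or.inl (hN i)]

end Determinants

end TracyWidom

end

theorem theorem1p3 (lam μ : YoungDiagram) (d d₁ d₂ : ℕ)
    (h₁ : lam.colLen 0 ≤ d₁) (h₂ : μ.colLen 0 ≤ d₂)
    (h : lam.colLen 0 ≤ d) (h' : μ.colLen 0 ≤ d) :
    (TracyWidom.ExpMixedSumFinite TracyWidom.dP TracyWidom.dPt
        (TracyWidom.TW d₁ lam ⊥ * TracyWidom.TW d₂ ⊥ μ) ∧
      TracyWidom.Delta (TracyWidom.TW d₁ lam ⊥ * TracyWidom.TW d₂ ⊥ μ) =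
        TracyWidom.TW d lam μ) ∧
    (TracyWidom.ExpMixedSumFinite TracyWidom.fatDP TracyWidom.fatDPt
        (TracyWidom.fatTW d₁ lam ⊥ * TracyWidom.fatTW d₂ ⊥ μ) ∧
      TracyWidom.fatDelta (TracyWidom.fatTW d₁ lam ⊥ * TracyWidom.fatTW d₂ ⊥ μ) =
        TracyWidom.fatTW d lam μ) := by
  rw [TracyWidom.TW, TracyWidom.TW, TracyWidom.TW, ← map_mul TracyWidom.specialize,
    ← TracyWidom.polyExp_schurDet_eq_fatTW lam μ d d₁ d₂ h₁ h₂ h h',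
    TracyWidom.fatTW_bot_right, TracyWidom.fatTW_bot_left, ← map_mul TracyWidom.psumEquivXY,
    TracyWidom.specialize_psumEquivXY, TracyWidom.specialize_psumEquivXY]
  exact ⟨TracyWidom.Delta_coe _, TracyWidom.fatDelta_psumEquivXY _⟩
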